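/- Let $G$ be a locally compact Hausdorff étale groupoid with unit space $G^{(0)}$, source and range maps $s,r$, and $G_x=s^{-1}(x)$ for $x\in G^{(0)}$. Let $C_c(G)$ be the $*$-algebra with product $(f*g)(\gamma)=\sum_{\alpha\in G_{s(\gamma)}}f(\gamma\alpha^{-1})g(\alpha)$ and involution $f^*(\gamma)=\overline{f(\gamma^{-1})}$. The reduced $C^*$-algebra $C^*_r(G)$ is its completion in $\|f\|_r=\sup_{x\in G^{(0)}}\|\lambda_x(f)\|$, where $(\lambda_x(f)\xi)(\gamma)=\sum_{\alpha\in G_x}f(\gamma\alpha^{-1})\xi(\alpha)$ for $\xi\in\ell^2(G_x)$. The maximal $C^*$-algebra $C^*(G)$ is its completion in $\|f\|_{\max}=\sup_\pi\|\pi(f)\|$, where $\pi$ runs over all $*$-representations of $C_c(G)$ on Hilbert spaces that are contractive for $\|f\|_I=\max\{\sup_x\sum_{\gamma\in G_x}|f(\gamma)|,\ \sup_x\sum_{\gamma\in G_x}|f^*(\gamma)|\}$. Suppose that $G$ has the weak containment property, i.e. the canonical quotient map $q\colon C^*(G)\to C^*_r(G)$, which is the identity on $C_c(G)$, is an isomorphism.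 A bisection is a set $B\subseteq G$ such that $s|_B$ and $r|_B$ are homeomorphisms onto their images; put $\alpha_B=r\circ(s|_B)^{-1}\colon s(B)\to r(B)$ and $\mathrm{Fix}(\alpha_B)=\{x\in s(B):\alpha_B(x)=x\}$. Let $\mu$ be a Radon probability measure on $G^{(0)}$ that is invariant, i.e. $\mu|_{r(B)}=(\alpha_B)_*(\mu|_{s(B)})$ for every open bisection $B$. A tracial state on $C^*_r(G)$ is a state $\tau$ with $\tau(ab)=\tau(ba)$ for all $a,b$; its associated measure is the Radon probability measure $\mu_\tau$ on $G^{(0)}$ with $\tau(f)=\int f\,d\mu_\tau$ for all $f\in C_0(G^{(0)})\subseteq C^*_r(G)$. Let $E\colon C^*_r(G)\to C_0(G^{(0)})$, $E(a)(u)=\langle\lambda_u(a)\delta_u,\delta_u\rangle$, be the canonical conditional expectation; $\tau$ is called canonical if $\tau(a)=\int_{G^{(0)}}E(a)\,d\mu_\tau$ for all $a\in C^*_r(G)$. Then the following are equivalent: (1) $G$ is essentially free with respect to $\mu$, i.e. $\mu(\mathrm{Fix}(\alpha_B))=0$ for every pre-compact open bisection $B\subseteq G\setminus G^{(0)}$;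 (2) every tracial state on $C^*_r(G)$ with associated measure $\mu$ is canonical. -/

import Mathlib

open scoped ENNReal CompactlySupported ComplexOrder ZeroAtInfty lp
open MeasureTheory Topology Filter
noncomputable section
namespace GroupoidCStar

/-! ### Operators on `ℓ²` given by matrices with bounded absolute row and column sums -/

lemma enorm_sum_sq_le {ι : Type*} (k : ι → ℂ) (ξ : ι → ℂ) :
    (∑' a, ‖k a * ξ a‖ₑ) ^ 2 ≤ (∑' a, ‖k a‖ₑ) * ∑' a, ‖k a‖ₑ * ‖ξ a‖ₑ ^ 2 := by
  set R : ℝ≥0∞ := (∑' a, ‖k a‖ₑ) * ∑' a, ‖k a‖ₑ * ‖ξ a‖ₑ ^ 2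
  suffices h : ∑' a, ‖k a * ξ a‖ₑ ≤ R ^ ((2 : ℝ)⁻¹) by
    have := (ENNReal.le_rpow_inv_iff (by norm_num : (0 : ℝ) < 2)).1 h
    exact_mod_cast this
  refine ENNReal.summable.tsum_le_of_sum_le fun s => ?_
  rw [ENNReal.le_rpow_inv_iff (by norm_num : (0 : ℝ) < 2)]
  have h1 : (∑ a ∈ s, ‖k a * ξ a‖₊) ^ 2 ≤
      (∑ a ∈ s, ‖k a‖₊) * ∑ a ∈ s, ‖k a‖₊ * ‖ξ a‖₊ ^ 2 :=
    Finset.sum_sq_le_sum_mul_sum_of_sq_le_mul s (fun _ _ => zero_le) (fun _ _ => zero_le)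
      (fun a _ => le_of_eq (by rw [nnnorm_mul]; ring))
  have h2 : (∑ a ∈ s, ‖k a * ξ a‖ₑ) ^ 2 ≤
      (∑ a ∈ s, ‖k a‖ₑ) * ∑ a ∈ s, ‖k a‖ₑ * ‖ξ a‖ₑ ^ 2 := by
    simp only [enorm_eq_nnnorm]
    exact_mod_cast h1
  calc (∑ a ∈ s, ‖k a * ξ a‖ₑ) ^ (2 : ℝ) = (∑ a ∈ s, ‖k a * ξ a‖ₑ) ^ 2 := by norm_cast
    _ ≤ _ := h2
    _ ≤ R := mul_le_mul' (ENNReal.sum_le_tsum s) (ENNReal.sum_le_tsum s)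

lemma schur_bound {ι : Type*} (k : ι → ι → ℂ) (C : ℝ≥0∞)
    (hrow : ∀ i, ∑' j, ‖k i j‖ₑ ≤ C) (hcol : ∀ j, ∑' i, ‖k i j‖ₑ ≤ C) (ξ : ι → ℂ) :
    ∑' i, ‖∑' j, k i j * ξ j‖ₑ ^ 2 ≤ C ^ 2 * ∑' j, ‖ξ j‖ₑ ^ 2 := by
  have htri : ∀ f : ι → ℂ, ‖∑' j, f j‖ₑ ≤ ∑' j, ‖f j‖ₑ := fun f => enorm_tsum_le_tsum_enorm
  calc ∑' i, ‖∑' j, k i j * ξ j‖ₑ ^ 2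
      ≤ ∑' i, (C * ∑' j, ‖k i j‖ₑ * ‖ξ j‖ₑ ^ 2) := by
        refine ENNReal.tsum_le_tsum fun i => ?_
        calc _ ≤ (∑' j, ‖k i j * ξ j‖ₑ) ^ 2 := by gcongr; exact htri _
          _ ≤ _ := enorm_sum_sq_le _ _
          _ ≤ _ := by gcongr; exact hrow i
    _ = C * ∑' j, ∑' i, ‖k i j‖ₑ * ‖ξ j‖ₑ ^ 2 := by
        rw [ENNReal.tsum_mul_left, ENNReal.tsum_comm]
    _ ≤ C * ∑' j, C * ‖ξ j‖ₑ ^ 2 := by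
        gcongr with j
        rw [ENNReal.tsum_mul_right]
        gcongr
        exact hcol j
    _ = _ := by rw [ENNReal.tsum_mul_left]; ring

lemma memlp_two_iff {ι : Type*} (ξ : ι → ℂ) :
    Memℓp ξ 2 ↔ ∑' j, ‖ξ j‖ₑ ^ 2 ≠ ∞ := by
  rw [memℓp_gen_iff (by norm_num)]
  have : ∀ j, ‖ξ j‖ₑ ^ 2 = ((‖ξ j‖₊ ^ 2 : NNReal) : ℝ≥0∞) := fun j => by
    simp [enorm_eq_nnnorm]
  simp_rw [this, ENNReal.tsum_coe_ne_top_iff_summable, ← NNReal.summable_coe]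
  simp

lemma enorm_sq_lp {ι : Type*} (ξ : ℓ²(ι, ℂ)) : ‖ξ‖ₑ ^ 2 = ∑' j, ‖ξ j‖ₑ ^ 2 := by
  have h := lp.hasSum_norm (p := 2) (by norm_num) ξ
  have h2 : HasSum (fun i => ‖ξ i‖ ^ 2) (‖ξ‖ ^ 2) := by simpa using h
  have h3 : HasSum (fun i => (‖ξ i‖₊ ^ 2 : NNReal)) (‖ξ‖₊ ^ 2) := by
    rw [← NNReal.hasSum_coe]; simpa using h2
  have h4 := ENNReal.hasSum_coe.2 h3
  rw [← (by simpa [enorm_eq_nnnorm] using h4.tsum_eq : ∑' j, ‖ξ j‖ₑ ^ 2 = ‖ξ‖ₑ ^ 2)]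

lemma summable_kernel_row {ι : Type*} {k : ι → ι → ℂ} {C : ℝ≥0∞} (hC : C ≠ ∞)
    (hrow : ∀ i, ∑' j, ‖k i j‖ₑ ≤ C) (ξ : ℓ²(ι, ℂ)) (i : ι) :
    Summable fun j => k i j * ξ j := by
  have hk : Summable fun j => ‖k i j‖ := by
    have := ne_top_of_le_ne_top hC (hrow i)
    simp_rw [enorm_eq_nnnorm, ENNReal.tsum_coe_ne_top_iff_summable] at this
    simpa using NNReal.summable_coe.2 this
  refine Summable.of_norm_bounded (hk.mul_right ‖ξ‖) fun j => ?_
  rw [norm_mul]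
  gcongr
  exact lp.norm_apply_le_norm (by norm_num) ξ j

/-- The bounded operator on `ℓ²(ι)` whose matrix `k` has absolute row and column sums
at most `C < ∞`. -/
def kernelOp {ι : Type*} (k : ι → ι → ℂ) (C : ℝ≥0∞) (hC : C ≠ ∞)
    (hrow : ∀ i, ∑' j, ‖k i j‖ₑ ≤ C) (hcol : ∀ j, ∑' i, ‖k i j‖ₑ ≤ C) :
    ℓ²(ι, ℂ) →L[ℂ] ℓ²(ι, ℂ) :=
  LinearMap.mkContinuous
    { toFun := fun ξ => ⟨fun i => ∑' j, k i j * ξ j, (memlp_two_iff _).2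
        (ne_top_of_le_ne_top (ENNReal.mul_ne_top (by finiteness)
          ((memlp_two_iff _).1 (lp.memℓp ξ))) (schur_bound k C hrow hcol ξ))⟩
      map_add' := fun ξ η => by
        ext i
        change ∑' j, k i j * (ξ j + η j) = ∑' j, k i j * ξ j + ∑' j, k i j * η j
        rw [← (summable_kernel_row hC hrow ξ i).tsum_add (summable_kernel_row hC hrow η i)]
        simp_rw [mul_add]
      map_smul' := fun c ξ => by
        ext i
        change ∑' j, k i j * (c * ξ j) = c * ∑' j, k i j * ξ j
        rw [← tsum_mul_left]
        congr 1; ext j; ring }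
    C.toReal (fun ξ => by
      have h := schur_bound k C hrow hcol ξ
      rw [← enorm_sq_lp, ← mul_pow] at h
      set η : ℓ²(ι, ℂ) := ⟨fun i => ∑' j, k i j * ξ j, (memlp_two_iff _).2
        (ne_top_of_le_ne_top (ENNReal.mul_ne_top (by finiteness)
          ((memlp_two_iff _).1 (lp.memℓp ξ))) (schur_bound k C hrow hcol ξ))⟩ with hη
      have h' : ‖η‖ₑ ^ 2 ≤ (C * ‖ξ‖ₑ) ^ 2 := by rw [enorm_sq_lp]; exact h
      have h'' : ‖η‖ₑ ≤ C * ‖ξ‖ₑ := (ENNReal.pow_le_pow_left_iff two_ne_zero).1 h'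
      have := ENNReal.toReal_mono (by finiteness) h''
      simpa using this)

lemma kernelOp_apply {ι : Type*} (k : ι → ι → ℂ) (C : ℝ≥0∞) (hC : C ≠ ∞)
    (hrow : ∀ i, ∑' j, ‖k i j‖ₑ ≤ C) (hcol : ∀ j, ∑' i, ‖k i j‖ₑ ≤ C) (ξ : ℓ²(ι, ℂ)) (i : ι) :
    kernelOp k C hC hrow hcol ξ i = ∑' j, k i j * ξ j := rfl

lemma kernelOp_enorm_le {ι : Type*} (k : ι → ι → ℂ) (C : ℝ≥0∞) (hC : C ≠ ∞)
    (hrow : ∀ i, ∑' j, ‖k i j‖ₑ ≤ C) (hcol : ∀ j, ∑' i, ‖k i j‖ₑ ≤ C) :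
    ‖kernelOp k C hC hrow hcol‖ₑ ≤ C := by
  have : ‖kernelOp k C hC hrow hcol‖ ≤ C.toReal :=
    LinearMap.mkContinuous_norm_le _ ENNReal.toReal_nonneg _
  rw [← ofReal_norm]
  exact (ENNReal.ofReal_le_ofReal this).trans_eq (ENNReal.ofReal_toReal hC)

open Classical in
/-- The standard basis vector `δ_j` of `ℓ²(ι)`. -/
def delta {ι : Type*} (j : ι) : ℓ²(ι, ℂ) := lp.single 2 j 1

lemma inner_delta_left {ι : Type*} (j : ι) (ξ : ℓ²(ι, ℂ)) : inner ℂ (delta j) ξ = ξ j := by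
  classical
  rw [delta, lp.inner_single_left]; simp

lemma inner_delta_right {ι : Type*} (j : ι) (ξ : ℓ²(ι, ℂ)) :
    inner ℂ ξ (delta j) = starRingEnd ℂ (ξ j) := by
  rw [← inner_conj_symm, inner_delta_left]

lemma op_ext {ι : Type*} {S T : ℓ²(ι, ℂ) →L[ℂ] ℓ²(ι, ℂ)}
    (h : ∀ i j, S (delta j) i = T (delta j) i) : S = T := by
  classical
  refine lp.ext_continuousLinearMap (by norm_num) fun j => ?_
  ext1
  ext i
  exact h i j

lemma kernelOp_delta {ι : Type*} (k : ι → ι → ℂ) (C : ℝ≥0∞) (hC : C ≠ ∞)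
    (hrow : ∀ i, ∑' j, ‖k i j‖ₑ ≤ C) (hcol : ∀ j, ∑' i, ‖k i j‖ₑ ≤ C) (i j : ι) :
    kernelOp k C hC hrow hcol (delta j) i = k i j := by
  classical
  rw [kernelOp_apply, tsum_eq_single j]
  · simp [delta]
  · intro b hb
    simp [delta, hb]

/-! ### Étale groupoids -/

/-- A groupoid, given by its set `G` of arrows. The units are the arrows `x` with `src x = x`;
the product `γ * η` carries a meaning only when `src γ = rng η`, and its values on the other
pairs are irrelevant. -/
class ArrowGroupoid (G : Type*) extends Mul G, Inv G where
  src : G → G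
  rng : G → G
  src_src : ∀ γ, src (src γ) = src γ
  rng_src : ∀ γ, rng (src γ) = src γ
  src_rng : ∀ γ, src (rng γ) = rng γ
  rng_rng : ∀ γ, rng (rng γ) = rng γ
  src_mul : ∀ γ η, src γ = rng η → src (γ * η) = src η
  rng_mul : ∀ γ η, src γ = rng η → rng (γ * η) = rng γ
  assoc : ∀ γ η ζ, src γ = rng η → src η = rng ζ → γ * η * ζ = γ * (η * ζ)
  mul_src : ∀ γ, γ * src γ = γ
  rng_mul_self : ∀ γ, rng γ * γ = γ
  src_inv : ∀ γ, src γ⁻¹ = rng γ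
  rng_inv : ∀ γ, rng γ⁻¹ = src γ
  inv_mul_self : ∀ γ, γ⁻¹ * γ = src γ
  mul_inv_self : ∀ γ, γ * γ⁻¹ = rng γ

open ArrowGroupoid

/-- The unit space `G⁰`, a subset of `G` with the subspace topology. -/
def unitSpace (G : Type*) [ArrowGroupoid G] : Set G := {x | src x = x}

/-- The source map `G → G⁰`. -/
def s {G : Type*} [ArrowGroupoid G] (γ : G) : unitSpace G := ⟨src γ, src_src γ⟩

/-- The range map `G → G⁰`. -/
def r {G : Type*} [ArrowGroupoid G] (γ : G) : unitSpace G := ⟨rng γ, src_rng γ⟩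

/-- The fibre `G_x = s⁻¹(x)`. -/
abbrev fiber {G : Type*} [ArrowGroupoid G] (x : unitSpace G) : Type _ := {γ : G // s γ = x}

/-- An étale topological groupoid: inversion, range, source and composition of composable pairs
are continuous, and the range map `G → G⁰` is a local homeomorphism. -/
class IsEtale (G : Type*) [TopologicalSpace G] [ArrowGroupoid G] : Prop where
  continuous_inv : Continuous fun γ : G => γ⁻¹
  continuous_src : Continuous (src : G → G)
  continuous_rng : Continuous (rng : G → G)
  continuousOn_mul : ContinuousOn (fun p : G × G => p.1 * p.2) {p | src p.1 = rng p.2}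
  isLocalHomeomorph_r : IsLocalHomeomorph (r : G → unitSpace G)

section algebra
variable {G : Type*} [ArrowGroupoid G]

lemma s_eq_iff {γ η : G} : s γ = s η ↔ src γ = src η := Subtype.ext_iff
lemma s_eq_coe {γ : G} {x : unitSpace G} : s γ = x ↔ src γ = x := Subtype.ext_iff

lemma s_unit (x : unitSpace G) : s (x : G) = x := Subtype.ext x.2

lemma rng_unit (x : unitSpace G) : rng (x : G) = x := by
  have := rng_src (x : G); rwa [show src (x : G) = x from x.2] at this

lemma inv_unit (x : unitSpace G) : (x : G)⁻¹ = x := by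
  have h1 := inv_mul_self (x : G)
  have h2 := mul_src ((x : G)⁻¹)
  rw [src_inv, rng_unit, h1] at h2
  rw [← h2]; exact x.2

lemma arrow_inv_inv (γ : G) : γ⁻¹⁻¹ = γ := by
  calc γ⁻¹⁻¹ = γ⁻¹⁻¹ * src γ⁻¹⁻¹ := (mul_src _).symm
    _ = γ⁻¹⁻¹ * (γ⁻¹ * γ) := by rw [src_inv, rng_inv, inv_mul_self]
    _ = γ⁻¹⁻¹ * γ⁻¹ * γ := (assoc _ _ _ (by rw [src_inv]) (by rw [src_inv])).symm
    _ = γ := by rw [inv_mul_self, src_inv, rng_mul_self]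

lemma arrow_mul_inv_cancel {γ η : G} (h : src γ = rng η) : γ * η * η⁻¹ = γ := by
  rw [assoc _ _ _ h (by rw [rng_inv]), mul_inv_self, ← h, mul_src]

lemma arrow_inv_mul_cancel {γ η : G} (h : src γ = src η) : γ * η⁻¹ * η = γ := by
  rw [assoc _ _ _ (by rw [rng_inv, h]) (by rw [src_inv]), inv_mul_self, ← h, mul_src]

lemma arrow_mul_inv_rev {γ η : G} (h : src γ = rng η) : (γ * η)⁻¹ = η⁻¹ * γ⁻¹ := by
  have e1 : src η⁻¹ = rng γ⁻¹ := by rw [src_inv, rng_inv, h]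
  have e2 : src (γ * η) = src η := src_mul _ _ h
  have e3 : rng (γ * η) = rng γ := rng_mul _ _ h
  have e4 : src (η⁻¹ * γ⁻¹) = rng γ := by rw [src_mul _ _ e1, src_inv]
  have e5 : (η⁻¹ * γ⁻¹) * (γ * η) = src η := by
    rw [assoc _ _ _ e1 (by rw [src_inv, e3]), ← assoc _ _ _ (by rw [src_inv]) h, inv_mul_self,
      h, rng_mul_self, inv_mul_self]
  calc (γ * η)⁻¹ = rng (γ * η)⁻¹ * (γ * η)⁻¹ := (rng_mul_self _).symm
    _ = (η⁻¹ * γ⁻¹) * (γ * η) * (γ * η)⁻¹ := by rw [rng_inv, e2, e5]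
    _ = η⁻¹ * γ⁻¹ := arrow_mul_inv_cancel (by rw [e4, e3])

lemma tsum_fiber_eq {K : Set G} (F : Finset G) (σ : G → unitSpace G → G) (x : unitSpace G)
    (h1 : ∀ a ∈ F, s (σ a x) = x) (h2 : Set.InjOn (fun a => σ a x) F)
    (h3 : ∀ β ∈ K, s β = x → ∃ a ∈ F, σ a x = β) (h : G → ℂ) (hh : ∀ γ ∉ K, h γ = 0) :
    ∑' α : fiber x, h α = ∑ a ∈ F, h (σ a x) := by
  classical
  rw [tsum_eq_sum (s := F.attach.image fun a : {a // a ∈ F} => (⟨σ a x, h1 a a.2⟩ : fiber x))]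
  · rw [Finset.sum_image, Finset.sum_attach F (fun a => h (σ a x))]
    intro a _ b _ hab
    exact Subtype.ext (h2 a.2 b.2 (congrArg Subtype.val hab))
  · intro β hβ
    apply hh
    intro hK
    obtain ⟨a, ha, hab⟩ := h3 β hK β.2
    exact hβ (Finset.mem_image.2 ⟨⟨a, ha⟩, Finset.mem_attach _ _, Subtype.ext hab⟩)

end algebra

section topology
variable {G : Type*} [TopologicalSpace G] [ArrowGroupoid G] [IsEtale G]

/-- Inversion as a homeomorphism. -/
def invHomeo (G : Type*) [TopologicalSpace G] [ArrowGroupoid G] [IsEtale G] : G ≃ₜ G where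
  toFun γ := γ⁻¹
  invFun γ := γ⁻¹
  left_inv := arrow_inv_inv
  right_inv := arrow_inv_inv
  continuous_toFun := IsEtale.continuous_inv
  continuous_invFun := IsEtale.continuous_inv

lemma isLocalHomeomorph_s : IsLocalHomeomorph (s : G → unitSpace G) := by
  have : (s : G → unitSpace G) = r ∘ invHomeo G := by
    ext γ; exact (rng_inv γ).symm
  rw [this]
  exact IsEtale.isLocalHomeomorph_r.comp (invHomeo G).isLocalHomeomorph

lemma continuous_s : Continuous (s : G → unitSpace G) := isLocalHomeomorph_s.continuous

lemma isClosed_unitSpace [T2Space G] : IsClosed (unitSpace G) :=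
  isClosed_eq IsEtale.continuous_src continuous_id

lemma isOpen_unitSpace : IsOpen (unitSpace G) := by
  rw [isOpen_iff_mem_nhds]
  intro x hx
  obtain ⟨e, hxe, he⟩ := isLocalHomeomorph_s (G := G) x
  have h1 : e.source ∈ 𝓝 x := e.open_source.mem_nhds hxe
  have h2 : src ⁻¹' e.source ∈ 𝓝 x := by
    refine IsEtale.continuous_src.continuousAt.preimage_mem_nhds ?_
    rw [show src x = x from hx]; exact h1
  filter_upwards [h1, h2] with γ hγ hγ'
  refine e.injOn hγ' hγ ?_
  rw [← he]
  exact s_eq_iff.2 (src_src γ)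

lemma exists_cover {K : Set G} (hK : IsCompact K) :
    ∃ (t : Finset G) (U : G → Set G), K ⊆ ⋃ a ∈ t, U a ∧ ∀ a, Set.InjOn (s : G → unitSpace G) (U a) := by
  choose e he hs using isLocalHomeomorph_s (G := G)
  obtain ⟨t, -, ht⟩ := hK.elim_nhds_subcover (fun a => (e a).source)
    (fun a _ => (e a).open_source.mem_nhds (he a))
  refine ⟨t, fun a => (e a).source, ht, fun a => ?_⟩
  have := (e a).injOn
  rwa [← hs a] at this

lemma finite_fiber {K : Set G} (hK : IsCompact K) (x : unitSpace G) :
    (K ∩ {γ | s γ = x}).Finite := by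
  obtain ⟨t, U, hKU, hU⟩ := exists_cover hK
  refine Set.Finite.subset (t.finite_toSet.biUnion (t := fun a => U a ∩ {γ | s γ = x}) fun a _ => ?_) ?_
  · exact Set.Subsingleton.finite fun γ h η h' => hU a h.1 h'.1 (h.2.trans h'.2.symm)
  · rintro γ ⟨h, h'⟩
    obtain ⟨a, ha, haU⟩ := Set.mem_iUnion₂.1 (hKU h)
    exact Set.mem_iUnion₂.2 ⟨a, ha, haU, h'⟩

lemma exists_local_sections [T2Space G] {K : Set G} (hK : IsCompact K) (x₀ : unitSpace G) :
    ∃ (F : Finset G) (σ : G → unitSpace G → G), (∀ a ∈ F, ContinuousAt (σ a) x₀) ∧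
      ∀ᶠ x in 𝓝 x₀, (∀ a ∈ F, s (σ a x) = x) ∧ Set.InjOn (fun a => σ a x) F ∧
        ∀ β ∈ K, s β = x → ∃ a ∈ F, σ a x = β := by
  choose e he hs using isLocalHomeomorph_s (G := G)
  have hfin := finite_fiber hK x₀
  obtain ⟨V, hV, hdisj⟩ := hfin.t2_separation
  set W : G → Set G := fun a => V a ∩ (e a).source with hW
  have hWo : ∀ a, IsOpen (W a) := fun a => (hV a).2.inter (e a).open_source
  have hWa : ∀ a, a ∈ W a := fun a => ⟨(hV a).1, he a⟩
  have hF : ∀ a ∈ hfin.toFinset, s a = x₀ := fun a ha => (hfin.mem_toFinset.1 ha).2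
  have hσ : ∀ a ∈ hfin.toFinset, ContinuousAt (e a).symm x₀ := fun a ha => by
    refine (e a).continuousAt_symm ?_
    rw [← hF a ha, hs a]
    exact (e a).map_source (he a)
  have hσ' : ∀ a ∈ hfin.toFinset, (e a).symm x₀ = a := fun a ha => by
    rw [← hF a ha]
    conv_lhs => rw [hs a]
    exact (e a).left_inv (he a)
  refine ⟨hfin.toFinset, fun a => (e a).symm, hσ, ?_⟩
  have h1 : ∀ᶠ x in 𝓝 x₀, ∀ a ∈ hfin.toFinset, (e a).symm x ∈ W a := by
    rw [Filter.eventually_all_finset]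
    intro a ha
    refine (hσ a ha).eventually_mem ?_
    rw [hσ' a ha]
    exact (hWo a).mem_nhds (hWa a)
  have h2 : ∀ᶠ x in 𝓝 x₀, ∀ a ∈ hfin.toFinset, x ∈ (e a).target := by
    rw [Filter.eventually_all_finset]
    intro a ha
    refine (e a).open_target.mem_nhds ?_
    rw [← hF a ha, hs a]
    exact (e a).map_source (he a)
  have hL : IsCompact (K \ ⋃ a ∈ hfin.toFinset, W a) :=
    hK.diff (isOpen_biUnion fun a _ => hWo a)
  have h3 : ∀ᶠ x in 𝓝 x₀, x ∉ s '' (K \ ⋃ a ∈ hfin.toFinset, W a) := by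
    refine (hL.image continuous_s).isClosed.isOpen_compl.mem_nhds ?_
    rintro ⟨β, ⟨hβ, hβ'⟩, hsβ⟩
    exact hβ' (Set.mem_iUnion₂.2 ⟨β, hfin.mem_toFinset.2 ⟨hβ, hsβ⟩, hWa β⟩)
  filter_upwards [h1, h2, h3] with x h1 h2 h3
  refine ⟨fun a ha => ?_, fun a ha b hb hab => ?_, fun β hβ hsβ => ?_⟩
  · have := (e a).right_inv (h2 a ha)
    rwa [← hs a] at this
  · by_contra hne
    have := hdisj (hfin.mem_toFinset.1 ha) (hfin.mem_toFinset.1 hb) hne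
    refine Set.disjoint_left.1 this (h1 a ha).1 ?_
    simp only at hab
    rw [hab]
    exact (h1 b hb).1
  · have : β ∈ ⋃ a ∈ hfin.toFinset, W a := by
      by_contra h
      exact h3 ⟨β, ⟨hβ, h⟩, hsβ⟩
    obtain ⟨a, ha, haW⟩ := Set.mem_iUnion₂.1 this
    refine ⟨a, ha, ?_⟩
    rw [← hsβ]
    conv_lhs => rw [hs a]
    exact (e a).left_inv haW.2

end topology

/-! ### The convolution algebra `C_c(G)` -/

/-- `C_c(G)`, to be equipped with convolution and involution (and not with the pointwise
product that Mathlib puts on `C_c(G, ℂ)`). -/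
def ConvAlg (G : Type*) [TopologicalSpace G] : Type _ := C_c(G, ℂ)

namespace ConvAlg
variable {G : Type*} [TopologicalSpace G]
instance : AddCommGroup (ConvAlg G) := inferInstanceAs (AddCommGroup C_c(G, ℂ))
instance : Module ℂ (ConvAlg G) := inferInstanceAs (Module ℂ C_c(G, ℂ))
instance : FunLike (ConvAlg G) G ℂ := inferInstanceAs (FunLike C_c(G, ℂ) G ℂ)

@[ext] lemma ext {f g : ConvAlg G} (h : ∀ γ, f γ = g γ) : f = g := DFunLike.ext _ _ h
lemma continuous (f : ConvAlg G) : Continuous f := f.toContinuousMap.continuous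
lemma hasCompactSupport (f : ConvAlg G) : HasCompactSupport f := f.hasCompactSupport'
@[simp] lemma zero_apply (γ : G) : (0 : ConvAlg G) γ = 0 := rfl
@[simp] lemma add_apply (f g : ConvAlg G) (γ : G) : (f + g) γ = f γ + g γ := rfl
@[simp] lemma smul_apply (c : ℂ) (f : ConvAlg G) (γ : G) : (c • f) γ = c * f γ := rfl
end ConvAlg

section conv
variable {G : Type*} [TopologicalSpace G] [ArrowGroupoid G] [IsEtale G]

/-- Convolution: `(f * g)(γ) = ∑_{α ∈ G_{s(γ)}} f(γ α⁻¹) g(α)`. -/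
def convFun (f g : G → ℂ) (γ : G) : ℂ := ∑' α : fiber (s γ), f (γ * (α : G)⁻¹) * g α

lemma continuous_convFun [T2Space G] (f g : ConvAlg G) : Continuous (convFun f g) := by
  rw [continuous_iff_continuousAt]
  intro γ₀
  obtain ⟨F, σ, hσ, hev⟩ := exists_local_sections g.hasCompactSupport.isCompact (s γ₀)
  have hev' := continuous_s.continuousAt.eventually hev
  have heq : (fun γ => ∑ a ∈ F, f (γ * (σ a (s γ))⁻¹) * g (σ a (s γ))) =ᶠ[𝓝 γ₀] convFun f g := by
    filter_upwards [hev'] with γ hγ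
    refine (tsum_fiber_eq F σ (s γ) hγ.1 hγ.2.1 hγ.2.2 (fun α => f (γ * α⁻¹) * g α) ?_).symm
    intro α hα
    rw [image_eq_zero_of_notMem_tsupport hα, mul_zero]
  refine ContinuousAt.congr ?_ heq
  refine tendsto_finsetSum _ fun a ha => ?_
  have hσa : ContinuousAt (fun γ => σ a (s γ)) γ₀ :=
    ContinuousAt.comp (f := s) (hσ a ha) continuous_s.continuousAt
  refine Tendsto.mul ?_ (g.continuous.continuousAt.comp hσa)
  refine (f.continuous.tendsto _).comp ?_
  have hmem : ∀ γ, s (σ a (s γ)) = s γ →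
      (γ, (σ a (s γ))⁻¹) ∈ {p : G × G | src p.1 = rng p.2} := fun γ h => by
    change src γ = rng (σ a (s γ))⁻¹
    rw [rng_inv]; exact (s_eq_iff.1 h).symm
  have hc := IsEtale.continuousOn_mul (G := G) (γ₀, (σ a (s γ₀))⁻¹)
    (hmem _ (hev'.self_of_nhds.1 a ha))
  refine Tendsto.comp (g := fun p : G × G => p.1 * p.2)
    (f := fun γ => (γ, (σ a (s γ))⁻¹)) hc (tendsto_nhdsWithin_iff.2 ⟨?_, ?_⟩)
  · exact ContinuousAt.prodMk continuousAt_id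
      (ContinuousAt.comp (f := fun γ => σ a (s γ)) IsEtale.continuous_inv.continuousAt hσa)
  · filter_upwards [hev'] with γ hγ
    exact hmem γ (hγ.1 a ha)

lemma hasCompactSupport_convFun [T2Space G] (f g : ConvAlg G) :
    HasCompactSupport (convFun f g) := by
  set P : Set (G × G) := (tsupport f ×ˢ tsupport g) ∩ {p | src p.1 = rng p.2} with hP
  have hPc : IsCompact P :=
    (f.hasCompactSupport.isCompact.prod g.hasCompactSupport.isCompact).inter_right
      (isClosed_eq (IsEtale.continuous_src.comp continuous_fst)
        (IsEtale.continuous_rng.comp continuous_snd))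
  refine HasCompactSupport.intro
    (hPc.image_of_continuousOn (IsEtale.continuousOn_mul.mono Set.inter_subset_right)) ?_
  intro γ hγ
  unfold convFun
  convert tsum_zero with α
  by_contra hne
  have hα : src γ = src (α : G) := (s_eq_iff.1 α.2).symm
  refine hγ ⟨(γ * (α : G)⁻¹, (α : G)), ⟨⟨?_, ?_⟩, ?_⟩, ?_⟩
  · exact subset_tsupport _ (left_ne_zero_of_mul hne)
  · exact subset_tsupport _ (right_ne_zero_of_mul hne)
  · change src (γ * (α : G)⁻¹) = rng (α : G)
    rw [src_mul _ _ (by rw [rng_inv, hα]), src_inv]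
  · exact arrow_inv_mul_cancel hα

instance [T2Space G] : Mul (ConvAlg G) where
  mul f g := ⟨⟨convFun f g, continuous_convFun f g⟩, hasCompactSupport_convFun f g⟩

/-- The involution `f^*(γ) = conj (f(γ⁻¹))`. -/
instance : Star (ConvAlg G) where
  star f := ⟨⟨fun γ => starRingEnd ℂ (f γ⁻¹),
      Complex.continuous_conj.comp (f.continuous.comp IsEtale.continuous_inv)⟩,
    (f.hasCompactSupport.comp_homeomorph (invHomeo G)).comp_left (map_zero _)⟩

lemma ConvAlg.mul_apply [T2Space G] (f g : ConvAlg G) (γ : G) :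
    (f * g) γ = ∑' α : fiber (s γ), f (γ * (α : G)⁻¹) * g α := rfl

lemma ConvAlg.star_apply (f : ConvAlg G) (γ : G) : (star f) γ = starRingEnd ℂ (f γ⁻¹) := rfl

end conv

/-! ### The `I`-norm and the left regular representations -/

/-- The `I`-norm of a function on `G`, as an extended nonnegative real
(recall `|f^*(γ)| = |f(γ⁻¹)|`). -/
def iNorm {G : Type*} [ArrowGroupoid G] (f : G → ℂ) : ℝ≥0∞ :=
  max (⨆ x : unitSpace G, ∑' γ : fiber x, ‖f γ‖ₑ)
    (⨆ x : unitSpace G, ∑' γ : fiber x, ‖starRingEnd ℂ (f (γ : G)⁻¹)‖ₑ)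

section regular
variable {G : Type*} [ArrowGroupoid G]

/-- For `γ ∈ G_x`, right translation is a bijection from `G_x` onto `G_{r(γ)}`. -/
def fiberEquiv {x : unitSpace G} (γ : fiber x) : fiber x ≃ fiber (r (γ : G)) where
  toFun α := ⟨α * (γ : G)⁻¹, Subtype.ext (by
    change src ((α : G) * (γ : G)⁻¹) = rng (γ : G)
    rw [src_mul _ _ (by rw [rng_inv, s_eq_iff.1 (α.2.trans γ.2.symm)]), src_inv])⟩
  invFun β := ⟨β * (γ : G), Subtype.ext (by
    change src ((β : G) * (γ : G)) = x
    rw [src_mul _ _ (congrArg Subtype.val β.2), s_eq_coe.1 γ.2])⟩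
  left_inv α := Subtype.ext (arrow_inv_mul_cancel (s_eq_iff.1 (α.2.trans γ.2.symm)))
  right_inv β := Subtype.ext (arrow_mul_inv_cancel (congrArg Subtype.val β.2))

lemma iNorm_row (f : G → ℂ) (x : unitSpace G) (γ : fiber x) :
    ∑' α : fiber x, ‖f (γ * (α : G)⁻¹)‖ₑ ≤ iNorm f := by
  have h : ∀ α : fiber x, (γ : G) * (α : G)⁻¹ = (fiberEquiv γ α : G)⁻¹ := fun α => by
    change _ = ((α : G) * (γ : G)⁻¹)⁻¹
    rw [arrow_mul_inv_rev (by rw [rng_inv, s_eq_iff.1 (α.2.trans γ.2.symm)]), arrow_inv_inv]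
  simp_rw [h]
  rw [(fiberEquiv γ).tsum_eq (fun β : fiber (r (γ : G)) => ‖f (β : G)⁻¹‖ₑ)]
  refine le_trans ?_ (le_max_right _ _)
  refine le_trans (le_of_eq ?_) (le_iSup _ (r (γ : G)))
  simp

lemma iNorm_col (f : G → ℂ) (x : unitSpace G) (α : fiber x) :
    ∑' γ : fiber x, ‖f (γ * (α : G)⁻¹)‖ₑ ≤ iNorm f := by
  change ∑' γ : fiber x, ‖f (fiberEquiv α γ : G)‖ₑ ≤ iNorm f
  rw [(fiberEquiv α).tsum_eq (fun β : fiber (r (α : G)) => ‖f (β : G)‖ₑ)]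
  exact le_trans (le_iSup (fun x : unitSpace G => ∑' γ : fiber x, ‖f γ‖ₑ) (r (α : G)))
    (le_max_left _ _)

/-- The operator `(λ_x(f) ξ)(γ) = ∑_{α ∈ G_x} f(γ α⁻¹) ξ(α)` on `ℓ²(G_x)`, for any function `f`
on `G` of finite `I`-norm. -/
def regularOp (x : unitSpace G) (f : G → ℂ) (hf : iNorm f ≠ ∞) :
    ℓ²(fiber x, ℂ) →L[ℂ] ℓ²(fiber x, ℂ) :=
  kernelOp (fun γ α : fiber x => f (γ * (α : G)⁻¹)) (iNorm f) hf (iNorm_row f x) (iNorm_col f x)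

lemma regularOp_apply (x : unitSpace G) (f : G → ℂ) (hf : iNorm f ≠ ∞) (ξ : ℓ²(fiber x, ℂ))
    (γ : fiber x) : regularOp x f hf ξ γ = ∑' α : fiber x, f (γ * (α : G)⁻¹) * ξ α := rfl

lemma regularOp_enorm_le (x : unitSpace G) (f : G → ℂ) (hf : iNorm f ≠ ∞) :
    ‖regularOp x f hf‖ₑ ≤ iNorm f := kernelOp_enorm_le _ _ _ _ _

lemma regularOp_delta (x : unitSpace G) (f : G → ℂ) (hf : iNorm f ≠ ∞) (γ α : fiber x) :
    regularOp x f hf (delta α) γ = f (γ * (α : G)⁻¹) := kernelOp_delta _ _ _ _ _ _ _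

variable [TopologicalSpace G] [IsEtale G]

lemma exists_fiber_bound (f : G → ℂ) (hf : Continuous f) (hs : HasCompactSupport f) :
    ∃ C : ℝ≥0∞, C ≠ ∞ ∧ ∀ x : unitSpace G, ∑' γ : fiber x, ‖f γ‖ₑ ≤ C := by
  obtain ⟨t, U, hKU, hU⟩ := exists_cover hs.isCompact
  obtain ⟨M, hM⟩ := hf.bounded_above_of_compact_support hs
  have hM' : ∀ γ, ‖f γ‖ₑ ≤ ENNReal.ofReal M := fun γ => by
    rw [← ofReal_norm]; exact ENNReal.ofReal_le_ofReal (hM γ)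
  refine ⟨∑ a ∈ t, ENNReal.ofReal M, by simp [ENNReal.mul_eq_top], fun x => ?_⟩
  classical
  calc ∑' γ : fiber x, ‖f γ‖ₑ
      ≤ ∑' γ : fiber x, ∑ a ∈ t, if (γ : G) ∈ U a then ‖f γ‖ₑ else 0 := by
        refine ENNReal.tsum_le_tsum fun γ => ?_
        by_cases h : f γ = 0
        · simp [h]
        · obtain ⟨a, ha, haU⟩ := Set.mem_iUnion₂.1 (hKU (subset_tsupport _ h))
          refine le_trans ?_ (Finset.single_le_sum (fun _ _ => zero_le) ha)
          simp [haU]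
    _ = ∑ a ∈ t, ∑' γ : fiber x, if (γ : G) ∈ U a then ‖f γ‖ₑ else 0 :=
        Summable.tsum_finsetSum fun _ _ => ENNReal.summable
    _ ≤ _ := by
        refine Finset.sum_le_sum fun a _ => ?_
        by_cases h : ∃ γ : fiber x, (γ : G) ∈ U a
        · obtain ⟨γ, hγ⟩ := h
          rw [tsum_eq_single γ]
          · simp [hγ, hM']
          · intro β hβ
            rw [if_neg]
            intro hβU
            exact hβ (Subtype.ext (hU a hβU hγ (β.2.trans γ.2.symm)))
        · push Not at h
          simp [h]

lemma ConvAlg.iNorm_ne_top (f : ConvAlg G) : iNorm f ≠ ∞ := by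
  obtain ⟨C, hC, h⟩ := exists_fiber_bound f f.continuous f.hasCompactSupport
  obtain ⟨D, hD, h'⟩ := exists_fiber_bound (star f : ConvAlg G) (star f : ConvAlg G).continuous
    (star f : ConvAlg G).hasCompactSupport
  exact ne_top_of_le_ne_top (max_lt hC.lt_top hD.lt_top).ne
    (max_le_max (iSup_le h) (iSup_le h'))

/-- The left regular operator `λ_x(f)` for `f ∈ C_c(G)`. -/
def regOp (x : unitSpace G) (f : ConvAlg G) : ℓ²(fiber x, ℂ) →L[ℂ] ℓ²(fiber x, ℂ) :=
  regularOp x f f.iNorm_ne_top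

lemma regOp_delta (x : unitSpace G) (f : ConvAlg G) (γ α : fiber x) :
    regOp x f (delta α) γ = f (γ * (α : G)⁻¹) := regularOp_delta _ _ _ _ _

lemma regOp_injective {f g : ConvAlg G} (h : ∀ x, regOp x f = regOp x g) : f = g := by
  ext γ
  have e : ∀ f : ConvAlg G,
      regOp (s γ) f (delta ⟨s γ, s_unit _⟩) ⟨γ, rfl⟩ = f γ := fun f => by
    rw [regOp_delta]
    change f (γ * (s γ : G)⁻¹) = f γ
    rw [inv_unit]
    exact congrArg f (mul_src γ)
  rw [← e f, ← e g, h]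

lemma regOp_add (x : unitSpace G) (f g : ConvAlg G) : regOp x (f + g) = regOp x f + regOp x g := by
  refine op_ext fun γ α => ?_
  rw [_root_.add_apply, lp.coeFn_add, Pi.add_apply]
  simp only [regOp_delta]; rfl

lemma regOp_smul (x : unitSpace G) (c : ℂ) (f : ConvAlg G) : regOp x (c • f) = c • regOp x f := by
  refine op_ext fun γ α => ?_
  rw [_root_.smul_apply, lp.coeFn_smul, Pi.smul_apply]
  simp only [regOp_delta]; rfl

lemma regOp_zero (x : unitSpace G) : regOp x (0 : ConvAlg G) = 0 := by
  refine op_ext fun γ α => ?_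
  rw [regOp_delta]; rfl

lemma regOp_mul [T2Space G] (x : unitSpace G) (f g : ConvAlg G) :
    regOp x (f * g) = regOp x f * regOp x g := by
  refine op_ext fun γ α => ?_
  rw [mul_apply_eq_comp, regOp_delta]
  conv_rhs => rw [regOp, regularOp_apply]
  simp only [regOp_delta]
  rw [ConvAlg.mul_apply]
  have hx : src (γ : G) = src (α : G) := s_eq_iff.1 (γ.2.trans α.2.symm)
  have hγα : src (γ : G) = rng (α : G)⁻¹ := by rw [rng_inv, hx]
  have hs : s ((γ : G) * (α : G)⁻¹) = r (α : G) := Subtype.ext (by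
    change src ((γ : G) * (α : G)⁻¹) = rng (α : G)
    rw [src_mul _ _ hγα, src_inv])
  rw [hs, ← (fiberEquiv α).tsum_eq]
  congr 1
  ext β
  change f ((γ : G) * (α : G)⁻¹ * ((β : G) * (α : G)⁻¹)⁻¹) * g ((β : G) * (α : G)⁻¹) = _
  have hβα : src (β : G) = rng (α : G)⁻¹ := by rw [rng_inv, s_eq_iff.1 (β.2.trans α.2.symm)]
  rw [arrow_mul_inv_rev hβα, arrow_inv_inv, ← assoc, arrow_inv_mul_cancel hx]
  · rw [src_mul _ _ hγα, src_inv]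
  · rw [rng_inv, s_eq_iff.1 (β.2.trans α.2.symm)]

lemma regOp_star (x : unitSpace G) (f : ConvAlg G) : regOp x (star f) = star (regOp x f) := by
  refine op_ext fun γ α => ?_
  rw [← inner_delta_left γ (star (regOp x f) (delta α)), ContinuousLinearMap.star_eq_adjoint,
    ContinuousLinearMap.adjoint_inner_right, inner_delta_right, regOp_delta, regOp_delta]
  have e : (γ : G) * (α : G)⁻¹ = ((α : G) * (γ : G)⁻¹)⁻¹ := by
    rw [arrow_mul_inv_rev (by rw [rng_inv, s_eq_iff.1 (α.2.trans γ.2.symm)]), arrow_inv_inv]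
  rw [ConvAlg.star_apply, e, arrow_inv_inv]

lemma regOp_enorm_le (x : unitSpace G) (f : ConvAlg G) : ‖regOp x f‖ₑ ≤ iNorm f :=
  regularOp_enorm_le _ _ _

end regular

section star_algebra
variable {G : Type*} [TopologicalSpace G] [T2Space G] [ArrowGroupoid G] [IsEtale G]

instance : NonUnitalRing (ConvAlg G) where
  left_distrib f g h := regOp_injective fun x => by simp [regOp_mul, regOp_add, mul_add]
  right_distrib f g h := regOp_injective fun x => by simp [regOp_mul, regOp_add, add_mul]
  zero_mul f := regOp_injective fun x => by simp [regOp_mul, regOp_zero]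
  mul_zero f := regOp_injective fun x => by simp [regOp_mul, regOp_zero]
  mul_assoc f g h := regOp_injective fun x => by simp [regOp_mul, mul_assoc]

instance : IsScalarTower ℂ (ConvAlg G) (ConvAlg G) where
  smul_assoc c f g := regOp_injective fun x => by simp [regOp_mul, regOp_smul]

instance : SMulCommClass ℂ (ConvAlg G) (ConvAlg G) where
  smul_comm c f g := regOp_injective fun x => by simp [regOp_mul, regOp_smul]

instance : StarRing (ConvAlg G) where
  star_involutive f := regOp_injective fun x => by simp [regOp_star]
  star_mul f g := regOp_injective fun x => by simp [regOp_star, regOp_mul]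
  star_add f g := regOp_injective fun x => by simp [regOp_star, regOp_add]

instance : StarModule ℂ (ConvAlg G) where
  star_smul c f := regOp_injective fun x => by simp [regOp_star, regOp_smul]

/-- The left regular representation `λ_x : C_c(G) → B(ℓ²(G_x))`. -/
def leftRegular (x : unitSpace G) : ConvAlg G →⋆ₙₐ[ℂ] (ℓ²(fiber x, ℂ) →L[ℂ] ℓ²(fiber x, ℂ)) where
  toFun := regOp x
  map_smul' := regOp_smul x
  map_zero' := regOp_zero x
  map_add' := regOp_add x
  map_mul' := regOp_mul x
  map_star' := regOp_star x

end star_algebra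

/-! ### The reduced and the maximal groupoid C*-algebra -/

section extend
variable {G : Type*} [ArrowGroupoid G]

open Classical in
/-- Extension of a function on `G⁰` by zero to `G`. -/
def extendZero (f : unitSpace G → ℂ) (γ : G) : ℂ := if h : γ ∈ unitSpace G then f ⟨γ, h⟩ else 0

lemma extendZero_coe (f : unitSpace G → ℂ) (x : unitSpace G) : extendZero f x = f x := by
  simp [extendZero]

lemma extendZero_of_notMem (f : unitSpace G → ℂ) {γ : G} (h : γ ∉ unitSpace G) :
    extendZero f γ = 0 := by simp [extendZero, h]

end extend

section cstar
universe u
variable (G : Type u) [TopologicalSpace G] [T2Space G] [ArrowGroupoid G] [IsEtale G]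

/-- A `*`-representation of `C_c(G)` on a Hilbert space that is contractive for the `I`-norm;
by continuity these are the contractive `*`-representations of the completion `L¹(G)`.
(Hilbert spaces in the universe of `G` suffice: cyclic representations live on completions of
quotients of `C_c(G)`.) -/
structure ContractiveRep : Type (u + 1) where
  H : Type u
  [instNACG : NormedAddCommGroup H]
  [instIPS : InnerProductSpace ℂ H]
  [instComplete : CompleteSpace H]
  π : ConvAlg G →⋆ₙₐ[ℂ] (H →L[ℂ] H)
  contractive : ∀ f, ‖π f‖ₑ ≤ iNorm f

attribute [instance] ContractiveRep.instNACG ContractiveRep.instIPS ContractiveRep.instComplete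

variable {G}

/-- The left regular representation at `x`, as a contractive representation. -/
def leftRegularRep (x : unitSpace G) : ContractiveRep G where
  H := ℓ²(fiber x, ℂ)
  π := leftRegular x
  contractive := regOp_enorm_le x

lemma memlp_infty_of_enorm_le {ι : Type*} {E : ι → Type*} [∀ i, NormedAddCommGroup (E i)]
    (a : ∀ i, E i) (C : ℝ≥0∞) (hC : C ≠ ∞) (h : ∀ i, ‖a i‖ₑ ≤ C) : Memℓp a ∞ := by
  refine memℓp_infty ⟨C.toReal, ?_⟩
  rintro _ ⟨i, rfl⟩
  simpa using ENNReal.toReal_mono hC (h i)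

variable (G)

/-- The C*-algebra `∏_x B(ℓ²(G_x))` of bounded families of operators, with the supremum norm. -/
def RegularProduct : Type u :=
  lp (fun x : unitSpace G => ℓ²(fiber x, ℂ) →L[ℂ] ℓ²(fiber x, ℂ)) ∞

/-- The C*-algebra of bounded families of operators indexed by all contractive representations. -/
def UniversalProduct : Type (u + 1) := lp (fun ρ : ContractiveRep G => ρ.H →L[ℂ] ρ.H) ∞

instance : NonUnitalCStarAlgebra (RegularProduct G) := inferInstanceAs (NonUnitalCStarAlgebra
  (lp (fun x : unitSpace G => ℓ²(fiber x, ℂ) →L[ℂ] ℓ²(fiber x, ℂ)) ∞))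

instance : NonUnitalCStarAlgebra (UniversalProduct G) := inferInstanceAs (NonUnitalCStarAlgebra
  (lp (fun ρ : ContractiveRep G => ρ.H →L[ℂ] ρ.H) ∞))

variable {G}

/-- The component of a family at `x`. -/
def RegularProduct.coord (a : RegularProduct G) (x : unitSpace G) :
    ℓ²(fiber x, ℂ) →L[ℂ] ℓ²(fiber x, ℂ) := a.1 x

/-- The component of a family at `ρ`. -/
def UniversalProduct.coord (a : UniversalProduct G) (ρ : ContractiveRep G) :
    ρ.H →L[ℂ] ρ.H := a.1 ρ

@[ext] lemma RegularProduct.ext {a b : RegularProduct G} (h : ∀ x, a.coord x = b.coord x) :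
    a = b := lp.ext (funext h)

@[ext] lemma UniversalProduct.ext {a b : UniversalProduct G} (h : ∀ ρ, a.coord ρ = b.coord ρ) :
    a = b := lp.ext (funext h)

lemma RegularProduct.norm_coord_le (a : RegularProduct G) (x : unitSpace G) :
    ‖a.coord x‖ ≤ ‖a‖ :=
  lp.norm_apply_le_norm (E := fun x : unitSpace G => ℓ²(fiber x, ℂ) →L[ℂ] ℓ²(fiber x, ℂ))
    ENNReal.top_ne_zero a x

lemma UniversalProduct.norm_coord_le (a : UniversalProduct G) (ρ : ContractiveRep G) :
    ‖a.coord ρ‖ ≤ ‖a‖ :=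
  lp.norm_apply_le_norm (E := fun ρ : ContractiveRep G => ρ.H →L[ℂ] ρ.H)
    ENNReal.top_ne_zero a ρ

lemma RegularProduct.norm_le {a : RegularProduct G} {C : ℝ} (hC : 0 ≤ C)
    (h : ∀ x, ‖a.coord x‖ ≤ C) : ‖a‖ ≤ C :=
  lp.norm_le_of_forall_le (E := fun x : unitSpace G => ℓ²(fiber x, ℂ) →L[ℂ] ℓ²(fiber x, ℂ)) hC h

variable (G)

/-- The direct sum `⊕_x λ_x : C_c(G) → ∏_x B(ℓ²(G_x))`; the target is the C*-algebra of bounded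
families of operators with the supremum norm, so that `‖regularSum f‖ = sup_x ‖λ_x(f)‖`. -/
def regularSum : ConvAlg G →⋆ₙₐ[ℂ] RegularProduct G where
  toFun f := ⟨fun x => leftRegular x f,
    memlp_infty_of_enorm_le _ _ f.iNorm_ne_top (fun x => regOp_enorm_le x f)⟩
  map_smul' c f := RegularProduct.ext fun x => map_smul (leftRegular x) c f
  map_zero' := RegularProduct.ext fun x => map_zero (leftRegular x)
  map_add' f g := RegularProduct.ext fun x => map_add (leftRegular x) f g
  map_mul' f g := RegularProduct.ext fun x => map_mul (leftRegular x) f g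
  map_star' f := RegularProduct.ext fun x => map_star (leftRegular x) f

/-- The direct sum of all contractive `*`-representations, so that `‖universalSum f‖ = ‖f‖_max`
is the supremum of `‖π f‖` over all of them. -/
def universalSum : ConvAlg G →⋆ₙₐ[ℂ] UniversalProduct G where
  toFun f := ⟨fun ρ => ρ.π f, memlp_infty_of_enorm_le _ _ f.iNorm_ne_top (fun ρ => ρ.contractive f)⟩
  map_smul' c f := UniversalProduct.ext fun ρ => map_smul ρ.π c f
  map_zero' := UniversalProduct.ext fun ρ => map_zero ρ.π
  map_add' f g := UniversalProduct.ext fun ρ => map_add ρ.π f g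
  map_mul' f g := UniversalProduct.ext fun ρ => map_mul ρ.π f g
  map_star' f := UniversalProduct.ext fun ρ => map_star ρ.π f

/-- The reduced C*-algebra `C*_r(G)`: the completion of `C_c(G)` in the reduced norm, realised as
the closure of the (isometric) image of `C_c(G)` in the C*-algebra `∏_x B(ℓ²(G_x))`. -/
def reducedSubalgebra : NonUnitalStarSubalgebra ℂ (RegularProduct G) :=
  (NonUnitalStarAlgHom.range (regularSum G)).topologicalClosure

/-- The maximal C*-algebra `C*(G)`: the completion of `C_c(G)` in the maximal norm, realised as
the closure of the (isometric) image of `C_c(G)` in the product of all `B(H)`. -/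
def maximalSubalgebra : NonUnitalStarSubalgebra ℂ (UniversalProduct G) :=
  (NonUnitalStarAlgHom.range (universalSum G)).topologicalClosure

instance : IsClosed (reducedSubalgebra G : Set (RegularProduct G)) := isClosed_closure

instance : IsClosed (maximalSubalgebra G : Set (UniversalProduct G)) := isClosed_closure

/-- `C*_r(G)` as a type. -/
abbrev ReducedCStar : Type u := reducedSubalgebra G

/-- `C*(G)` as a type. -/
abbrev MaximalCStar : Type (u + 1) := maximalSubalgebra G

instance : NonUnitalCStarAlgebra (ReducedCStar G) :=
  NonUnitalStarSubalgebra.nonUnitalCStarAlgebra (reducedSubalgebra G)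

instance : NonUnitalCStarAlgebra (MaximalCStar G) :=
  NonUnitalStarSubalgebra.nonUnitalCStarAlgebra (maximalSubalgebra G)

/-- Restriction of a family indexed by all contractive representations to the `λ_x`. -/
def restrictToRegular : UniversalProduct G →⋆ₙₐ[ℂ] RegularProduct G where
  toFun a := ⟨fun x => a.coord (leftRegularRep x), memℓp_infty ⟨‖a‖, by
    rintro _ ⟨x, rfl⟩
    exact a.norm_coord_le (leftRegularRep x)⟩⟩
  map_smul' _ _ := rfl
  map_zero' := rfl
  map_add' _ _ := rfl
  map_mul' _ _ := rfl
  map_star' _ := rfl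

lemma continuous_restrictToRegular : Continuous (restrictToRegular G) := by
  refine AddMonoidHomClass.continuous_of_bound (restrictToRegular G) 1 fun a => ?_
  rw [one_mul]
  exact RegularProduct.norm_le (norm_nonneg _) fun x => a.norm_coord_le (leftRegularRep x)

lemma restrictToRegular_mem (a : MaximalCStar G) :
    restrictToRegular G a.1 ∈ reducedSubalgebra G := by
  refine map_mem_closure (continuous_restrictToRegular G) a.2 ?_
  rintro _ ⟨f, rfl⟩
  exact ⟨f, rfl⟩

/-- The canonical quotient map `q : C*(G) → C*_r(G)`, the identity on `C_c(G)`. -/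
def canonicalQuotient : MaximalCStar G →⋆ₙₐ[ℂ] ReducedCStar G :=
  NonUnitalStarAlgHom.codRestrict
    ((restrictToRegular G).comp (NonUnitalStarSubalgebraClass.subtype (maximalSubalgebra G)))
    (reducedSubalgebra G) (restrictToRegular_mem G)

/-- The canonical copy of `f ∈ C_c(G)` in `C*_r(G)`. -/
def toReduced (f : ConvAlg G) : ReducedCStar G := ⟨regularSum G f, subset_closure ⟨f, rfl⟩⟩

/-- The canonical copy of `f ∈ C_c(G)` in `C*(G)`. -/
def toMaximal (f : ConvAlg G) : MaximalCStar G := ⟨universalSum G f, subset_closure ⟨f, rfl⟩⟩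

lemma canonicalQuotient_toMaximal (f : ConvAlg G) : canonicalQuotient G (toMaximal G f) = toReduced G f := rfl

lemma norm_toReduced (f : ConvAlg G) : ‖toReduced G f‖ = ⨆ x, ‖leftRegular x f‖ :=
  lp.norm_eq_ciSup (regularSum G f)

lemma norm_toMaximal (f : ConvAlg G) : ‖toMaximal G f‖ = ⨆ ρ : ContractiveRep G, ‖ρ.π f‖ :=
  lp.norm_eq_ciSup (universalSum G f)

lemma toReduced_injective : Function.Injective (toReduced G) := fun _ _ h =>
  regOp_injective fun x => congrArg (fun a : ReducedCStar G => a.1.coord x) h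

/-- The weak containment property: `q : C*(G) → C*_r(G)` is an isomorphism. -/
def WeakContainment : Prop := Function.Bijective (canonicalQuotient G)

variable {G}

/-! ### `C_0(G⁰)` inside `C*_r(G)` and the conditional expectation -/

lemma iNorm_extendZero_le (f : unitSpace G → ℂ) (C : ℝ≥0∞) (hf : ∀ x, ‖f x‖ₑ ≤ C) :
    iNorm (extendZero f) ≤ C := by
  have hC : ∀ γ, ‖extendZero f γ‖ₑ ≤ C := fun γ => by
    by_cases h : γ ∈ unitSpace G
    · exact (congrArg _ (extendZero_coe f ⟨γ, h⟩)).trans_le (hf _)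
    · simp [extendZero_of_notMem f h]
  have hinv : ∀ γ : G, γ ∉ unitSpace G → γ⁻¹ ∉ unitSpace G := fun γ h h' => h (by
    have := inv_unit (⟨γ⁻¹, h'⟩ : unitSpace G)
    simp only [arrow_inv_inv] at this
    rw [this]; exact h')
  have hne : ∀ (x : unitSpace G) (γ : fiber x), γ ≠ ⟨x, s_unit x⟩ → (γ : G) ∉ unitSpace G :=
    fun x γ hγ h => hγ (Subtype.ext ((show src (γ : G) = γ from h).symm.trans (s_eq_coe.1 γ.2)))
  refine max_le (iSup_le fun x => ?_) (iSup_le fun x => ?_)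
  · rw [tsum_eq_single ⟨x, s_unit x⟩]
    · exact hC _
    · intro γ hγ
      rw [extendZero_of_notMem f (hne x γ hγ), enorm_zero]
  · rw [tsum_eq_single ⟨x, s_unit x⟩]
    · simpa using hC _
    · intro γ hγ
      rw [extendZero_of_notMem f (hinv _ (hne x γ hγ)), map_zero, enorm_zero]

lemma iNorm_extendZero_ne_top (f : C₀(unitSpace G, ℂ)) : iNorm (extendZero f) ≠ ∞ := by
  refine ne_top_of_le_ne_top enorm_ne_top (iNorm_extendZero_le f ‖f.toBCF‖ₑ fun x => ?_)
  rw [enorm_le_iff_norm_le]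
  exact f.toBCF.norm_coe_le_norm x

/-- The family `(λ_x(f))_x`, where `f ∈ C_0(G⁰)` is extended by zero to `G`. -/
def unitFunFamily (f : C₀(unitSpace G, ℂ)) : RegularProduct G :=
  ⟨fun x => regularOp x (extendZero f) (iNorm_extendZero_ne_top f),
    memlp_infty_of_enorm_le _ _ (iNorm_extendZero_ne_top f) fun x => regularOp_enorm_le x _ _⟩

lemma continuous_extendZero {f : unitSpace G → ℂ} (hf : Continuous f) :
    Continuous (extendZero f) := by
  classical
  rw [continuous_iff_continuousAt]
  intro γ
  by_cases h : γ ∈ unitSpace G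
  · have : ContinuousAt (extendZero f ∘ ((↑) : unitSpace G → G)) ⟨γ, h⟩ := by
      refine hf.continuousAt.congr (Eventually.of_forall fun x => (extendZero_coe f x).symm)
    exact (isOpen_unitSpace.isOpenEmbedding_subtypeVal.continuousAt_iff).1 this
  · refine (continuousAt_const (y := (0 : ℂ))).congr ?_
    filter_upwards [isClosed_unitSpace.isOpen_compl.mem_nhds h] with η hη
    exact (extendZero_of_notMem f hη).symm

lemma exists_approx (f : C₀(unitSpace G, ℂ)) {ε : ℝ} (hε : 0 < ε) :
    ∃ g : ConvAlg G, ∃ d : unitSpace G → ℂ, (∀ x, ‖d x‖ ≤ 2 * ε) ∧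
      ∀ γ, extendZero f γ - g γ = extendZero d γ := by
  set χ : ℂ → ℂ := fun z => ((max 0 (min 1 (‖z‖ / ε - 1)) : ℝ) : ℂ) with hχ
  have hχc : Continuous χ := by fun_prop
  have hcpt : IsCompact {x : unitSpace G | ε ≤ ‖f x‖} := by
    have h := f.zero_at_infty'
    have h2 : {x : unitSpace G | ‖f x‖ < ε} ∈ cocompact (unitSpace G) := by
      have := h (Metric.ball_mem_nhds (0 : ℂ) hε)
      filter_upwards [this] with x hx
      simpa using hx
    obtain ⟨K, hK, hK'⟩ := mem_cocompact.1 h2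
    refine hK.of_isClosed_subset (isClosed_le continuous_const (by fun_prop)) fun x hx => ?_
    by_contra hxK
    exact not_lt.2 (show ε ≤ ‖f x‖ from hx) (hK' hxK)
  have hsmall : ∀ z : ℂ, ‖z‖ < ε → χ z = 0 := fun z hz => by
    have : ‖z‖ / ε < 1 := (div_lt_one hε).2 hz
    have h : min 1 (‖z‖ / ε - 1) ≤ 0 := (min_le_right _ _).trans (by linarith)
    simp [hχ, max_eq_left h]
  have hfc := continuous_extendZero (G := G) f.continuous
  refine ⟨⟨⟨fun γ => extendZero f γ * χ (extendZero f γ), hfc.mul (hχc.comp hfc)⟩, ?_⟩,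
    fun x => f x - f x * χ (f x), fun x => ?_, fun γ => ?_⟩
  · refine HasCompactSupport.intro (hcpt.image continuous_subtype_val) fun γ hγ => ?_
    by_cases h : γ ∈ unitSpace G
    · have e : extendZero f γ = f ⟨γ, h⟩ := extendZero_coe f ⟨γ, h⟩
      have : ‖f ⟨γ, h⟩‖ < ε := by
        by_contra hlt
        exact hγ ⟨⟨γ, h⟩, not_lt.1 hlt, rfl⟩
      change extendZero f γ * χ (extendZero f γ) = 0
      rw [e, hsmall _ this, mul_zero]
    · change extendZero f γ * χ (extendZero f γ) = 0
      rw [extendZero_of_notMem f h, zero_mul]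
  · set t : ℝ := max 0 (min 1 (‖f x‖ / ε - 1)) with ht
    have ht0 : 0 ≤ t := le_max_left _ _
    have ht1 : t ≤ 1 := max_le zero_le_one (min_le_left _ _)
    have e : f x - f x * χ (f x) = f x * ((1 - t : ℝ) : ℂ) := by
      simp only [hχ, ← ht]; push_cast; ring
    change ‖f x - f x * χ (f x)‖ ≤ _
    rw [e, norm_mul, Complex.norm_real, Real.norm_of_nonneg (by linarith)]
    by_cases h : ‖f x‖ ≤ 2 * ε
    · nlinarith [norm_nonneg (f x)]
    · have h1 : 1 ≤ ‖f x‖ / ε - 1 := by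
        have : 2 ≤ ‖f x‖ / ε := (le_div_iff₀ hε).2 (not_le.1 h).le
        linarith
      have : t = 1 := by rw [ht, min_eq_left h1]; simp
      rw [this]; simp; positivity
  · change extendZero f γ - extendZero f γ * χ (extendZero f γ) = _
    by_cases h : γ ∈ unitSpace G
    · lift γ to unitSpace G using h
      simp only [extendZero_coe]
    · simp [extendZero_of_notMem _ h]

lemma unitFunFamily_mem (f : C₀(unitSpace G, ℂ)) : unitFunFamily f ∈ reducedSubalgebra G := by
  change unitFunFamily f ∈ closure (Set.range (regularSum G))
  rw [Metric.mem_closure_range_iff]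
  intro ε hε
  obtain ⟨g, d, hd, hgd⟩ := exists_approx f (ε := ε / 4) (by positivity)
  refine ⟨g, ?_⟩
  rw [dist_eq_norm]
  refine lt_of_le_of_lt (b := 2 * (ε / 4)) ?_ (by linarith)
  refine RegularProduct.norm_le (by positivity) fun x => ?_
  have hle : iNorm (extendZero d) ≤ ENNReal.ofReal (2 * (ε / 4)) :=
    iNorm_extendZero_le d _ fun y => by
      rw [← ofReal_norm]; exact ENNReal.ofReal_le_ofReal (hd y)
  have hne : iNorm (extendZero d) ≠ ∞ := ne_top_of_le_ne_top ENNReal.ofReal_ne_top hle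
  have e : (unitFunFamily f - regularSum G g).coord x = regularOp x (extendZero d) hne := by
    refine op_ext fun γ α => ?_
    rw [regularOp_delta, ← hgd]
    change regularOp x (extendZero f) (iNorm_extendZero_ne_top f) (delta α) γ - regOp x g (delta α) γ = _
    congr 1
    · exact regularOp_delta _ _ _ _ _
    · exact regOp_delta _ _ _ _
  rw [e]
  have := (regularOp_enorm_le x (extendZero d) hne).trans hle
  rwa [← ofReal_norm, ENNReal.ofReal_le_ofReal_iff (by positivity)] at this

/-- The inclusion `ι : C_0(G⁰) → C*_r(G)`, extending a function by zero off `G⁰`. -/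
def unitInclusion (f : C₀(unitSpace G, ℂ)) : ReducedCStar G :=
  ⟨unitFunFamily f, unitFunFamily_mem f⟩

/-- The conditional expectation `E(a)(u) = ⟨λ_u(a) δ_u, δ_u⟩` (the scalar product of Mathlib is
linear in the second variable). -/
def unitExpectation (a : ReducedCStar G) (u : unitSpace G) : ℂ :=
  inner ℂ (delta (⟨u, s_unit u⟩ : fiber u)) (a.1.coord u (delta ⟨u, s_unit u⟩))

end cstar

/-- A tracial state on a C*-algebra: a positive linear functional of norm one with
`τ(ab) = τ(ba)`. -/
structure IsTracialState {A : Type*} [NonUnitalCStarAlgebra A] (τ : A →L[ℂ] ℂ) : Prop where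
  nonneg : ∀ a, 0 ≤ τ (star a * a)
  norm_eq_one : ‖τ‖ = 1
  tracial : ∀ a b, τ (a * b) = τ (b * a)

/-! ### Bisections, invariant measures, essential freeness -/

section bisection
variable {G : Type*} [TopologicalSpace G] [ArrowGroupoid G]

/-- `B` is a bisection: the restrictions of `s` and `r` to `B` are homeomorphisms onto their
images. -/
def IsBisection (B : Set G) : Prop :=
  IsEmbedding (fun γ : B => s (γ : G)) ∧ IsEmbedding (fun γ : B => r (γ : G))

/-- `α_B : s(B) → G⁰`, `x ↦ r((s|_B)⁻¹(x))`, for a bisection `B`. -/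
def bisectionMap (B : Set G) (x : s '' B) : unitSpace G := r x.2.choose

/-- The fixed points of `α_B`. -/
def fixedPoints (B : Set G) : Set (unitSpace G) :=
  {x | ∃ h : x ∈ s '' B, bisectionMap B ⟨x, h⟩ = x}

variable [MeasurableSpace (unitSpace G)]

/-- `μ` is invariant: `μ|_{r(B)} = (α_B)_* (μ|_{s(B)})` for every open bisection `B`. -/
def IsInvariant (μ : Measure (unitSpace G)) : Prop :=
  ∀ B : Set G, IsOpen B → IsBisection B →
    μ.restrict (r '' B) = (μ.comap ((↑) : s '' B → unitSpace G)).map (bisectionMap B)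

/-- `G` is essentially free with respect to `μ`: `μ(Fix(α_B)) = 0` for every pre-compact open
bisection `B ⊆ G \ G⁰`. -/
def IsEssentiallyFree (μ : Measure (unitSpace G)) : Prop :=
  ∀ B : Set G, IsOpen B → IsBisection B → IsCompact (closure B) → B ⊆ (unitSpace G)ᶜ →
    μ (fixedPoints B) = 0

variable [T2Space G] [IsEtale G]

/-- `μ` is the associated measure of the functional `τ` on `C*_r(G)`: `τ(f) = ∫ f dμ` for all
`f ∈ C_0(G⁰)`. -/
def IsAssociatedMeasure (τ : ReducedCStar G →L[ℂ] ℂ) (μ : Measure (unitSpace G)) : Prop :=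
  ∀ f : C₀(unitSpace G, ℂ), τ (unitInclusion f) = ∫ x, f x ∂μ

/-- `τ_μ(a) = ∫ E(a) dμ`. -/
def traceOf (μ : Measure (unitSpace G)) (a : ReducedCStar G) : ℂ := ∫ u, unitExpectation a u ∂μ

/-- `τ` is canonical: `τ = τ_μ` for the associated Radon probability measure `μ` of `τ`. -/
def IsCanonical (τ : ReducedCStar G →L[ℂ] ℂ) : Prop :=
  ∃ μ : Measure (unitSpace G), IsProbabilityMeasure μ ∧ μ.Regular ∧
    IsAssociatedMeasure τ μ ∧ ∀ a, τ a = traceOf μ a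

end bisection

end GroupoidCStar
end

open GroupoidCStar MeasureTheory

/-!
(1) ⇒ (2): a trace `τ` with measure `μ` kills every `f ∈ C_c(G)` whose support misses the isotropy
bundle `Iso(G)`: locally `f = f * h` and `h * f = 0` for some `h ∈ C_c(G⁰)`, so
`τ(f) = τ(f * h) = τ(h * f) = 0`. For general `f`, a cutoff `h ∈ C_c(G⁰)` equal to `1` near the
sources of the isotropy arrows in `supp f` therefore satisfies `τ(f) = τ(f * h)`, and Cauchy–Schwarz
gives `|τ(f)|² ≤ τ(f * f⋆) ∫ |h|² dμ`. If those sources form a `μ`-null set, then `τ(f) = 0`.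
Essential freeness provides this locally off `G⁰`, where also `E(f) = 0`.

(2) ⇒ (1): `C_c(G)` acts on `ℓ²(G⁰)` by `δ_x ↦ ∑_{γ ∈ G_x} f(γ) δ_{r(γ)}`, contractively for the
`I`-norm, and by weak containment this representation extends to `C*_r(G)`. Its vector functional at
`δ_x` is `f ↦ ∑_{γ ∈ G_x^x} f(γ)`, the sum over the isotropy group; integrating over an invariant
`μ` gives a tracial state with measure `μ`. If it is canonical, then for `f` vanishing on `G⁰` the
integral of these sums is `∫ E(f) dμ = 0`. Testing on cutoffs `f` of a compact
`L ⊆ Iso(G) \ G⁰` gives `μ(s(L)) = 0`, and inner regularity makes the fixed point sets null.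
-/

noncomputable section
namespace GroupoidCStar
open ArrowGroupoid

section CompactSupport
variable {X : Type*} [TopologicalSpace X]

/-- A real compactly supported function, regarded as a complex one. -/
def toComplex (χ : C_c(X, ℝ)) : C_c(X, ℂ) := χ.compLeft ⟨Complex.ofReal, Complex.continuous_ofReal⟩

@[simp] lemma toComplex_apply (χ : C_c(X, ℝ)) (x : X) : toComplex χ x = χ x :=
  CompactlySupportedContinuousMap.compLeft_apply Complex.ofReal_zero χ x

variable [T2Space X] [LocallyCompactSpace X]

lemma exists_cutoff {K V : Set X} (hK : IsCompact K) (hV : IsOpen V) (hKV : K ⊆ V) :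
    ∃ χ : C_c(X, ℝ), Set.EqOn χ 1 K ∧ tsupport χ ⊆ V ∧ ∀ x, χ x ∈ Set.Icc (0 : ℝ) 1 := by
  obtain ⟨χ, hχ, hχc, hχV, hχ01⟩ := exists_continuousMap_one_of_isCompact_subset_isOpen hK hV hKV
  exact ⟨⟨χ, hχc⟩, hχ, hχV, hχ01⟩

lemma compactlySupported_local_induction {E : Type*} [AddCommGroup E] [TopologicalSpace E]
    [IsTopologicalAddGroup E] [Module ℝ E] [ContinuousSMul ℝ E] {P : C_c(X, E) → Prop}
    (zero : P 0) (add : ∀ f g, P f → P g → P (f + g)) (f : C_c(X, E))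
    (loc : ∀ x ∈ tsupport f, ∃ U : Set X, IsOpen U ∧ x ∈ U ∧
      ∀ g : C_c(X, E), tsupport g ⊆ U → P g) : P f := by
  choose! U hUo hU hP using loc
  obtain ⟨t, ht, hcov⟩ := f.hasCompactSupport.isCompact.elim_nhds_subcover U
    fun x hx => (hUo x hx).mem_nhds (hU x hx)
  set e := t.equivFin
  obtain ⟨φ, hφ, hsum, -, -⟩ := exists_continuous_sum_one_of_isOpen_isCompact
    (s := fun i => U (e.symm i)) (fun i => hUo _ (ht _ (e.symm i).2))
    f.hasCompactSupport.isCompact fun x hx => by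
      obtain ⟨a, ha, haU⟩ := Set.mem_iUnion₂.1 (hcov hx)
      exact Set.mem_iUnion.2 ⟨e ⟨a, ha⟩, by simpa using haU⟩
  have hf : f = ∑ i, φ i • f := by
    ext x
    simp only [CompactlySupportedContinuousMap.sum_apply,
      CompactlySupportedContinuousMap.smulc_apply, ← Finset.sum_smul]
    by_cases hx : x ∈ tsupport f
    · rw [← Finset.sum_apply, hsum hx, Pi.one_apply, one_smul]
    · rw [image_eq_zero_of_notMem_tsupport hx, smul_zero]
  rw [hf]
  exact Finset.sum_induction _ P add zero fun i _ =>
    hP _ (ht _ (e.symm i).2) _ ((tsupport_smul_subset_left (φ i) f).trans (hφ i))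

lemma ConvAlg.local_induction {P : ConvAlg X → Prop}
    (zero : P 0) (add : ∀ f g, P f → P g → P (f + g)) (f : ConvAlg X)
    (loc : ∀ γ ∈ tsupport f, ∃ U : Set X, IsOpen U ∧ γ ∈ U ∧
      ∀ g : ConvAlg X, tsupport g ⊆ U → P g) : P f :=
  compactlySupported_local_induction (E := ℂ) zero add f loc

end CompactSupport

section Isotropy
variable {G : Type*} [ArrowGroupoid G]

/-- The isotropy bundle `Iso(G)`. -/
def isotropy (G : Type*) [ArrowGroupoid G] : Set G := {γ | s γ = r γ}

lemma s_inv (γ : G) : s γ⁻¹ = r γ := Subtype.ext (src_inv γ)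

lemma r_inv (γ : G) : r γ⁻¹ = s γ := Subtype.ext (rng_inv γ)

lemma r_mul_inv {γ α : G} (h : s γ = s α) : r (γ * α⁻¹) = r γ :=
  Subtype.ext (rng_mul _ _ (by rw [rng_inv, s_eq_iff.1 h]))

lemma injOn_s_unitSpace : (unitSpace G).InjOn s := fun γ hγ η hη h => by
  rw [← show src γ = γ from hγ, ← show src η = η from hη, s_eq_iff.1 h]

lemma r_unit (x : unitSpace G) : r (x : G) = x := Subtype.ext (rng_unit x)

lemma inv_mem_unitSpace {γ : G} : γ⁻¹ ∈ unitSpace G ↔ γ ∈ unitSpace G := by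
  have inv_mem {η : G} (hη : η ∈ unitSpace G) : η⁻¹ ∈ unitSpace G := by
    rwa [inv_unit ⟨η, hη⟩]
  exact ⟨fun h => arrow_inv_inv γ ▸ inv_mem h, inv_mem⟩

lemma eq_of_mul_inv_mem_unitSpace {γ η : G} (h : s γ = s η) (hu : γ * η⁻¹ ∈ unitSpace G) :
    γ = η := by
  have hsrc : src γ = src η := s_eq_iff.1 h
  have hcomp : src γ = rng η⁻¹ := by rw [rng_inv, hsrc]
  have hunit : γ * η⁻¹ = rng η := by
    rw [← src_inv η, ← src_mul γ η⁻¹ hcomp]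
    exact hu.symm
  rw [← arrow_inv_mul_cancel hsrc, hunit, rng_mul_self]

variable [TopologicalSpace G] [IsEtale G]

lemma continuous_r : Continuous (r : G → unitSpace G) := IsEtale.isLocalHomeomorph_r.continuous

lemma isOpenMap_s : IsOpenMap (s : G → unitSpace G) := isLocalHomeomorph_s.isOpenMap

lemma isOpenMap_r : IsOpenMap (r : G → unitSpace G) := IsEtale.isLocalHomeomorph_r.isOpenMap

lemma isClosed_isotropy [T2Space G] : IsClosed (isotropy G) := isClosed_eq continuous_s continuous_r

end Isotropy

section Bisection
variable {G : Type*} [TopologicalSpace G] [ArrowGroupoid G] {B C : Set G}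

lemma IsBisection.injOn_s (hB : IsBisection B) : B.InjOn s :=
  Set.injOn_iff_injective.2 hB.1.injective

lemma IsBisection.injOn_r (hB : IsBisection B) : B.InjOn r :=
  Set.injOn_iff_injective.2 hB.2.injective

lemma bisectionMap_s (hB : IsBisection B) {γ : G} (hγ : γ ∈ B) (h : s γ ∈ s '' B) :
    bisectionMap B ⟨s γ, h⟩ = r γ :=
  congrArg r (hB.injOn_s h.choose_spec.1 hγ h.choose_spec.2)

lemma IsBisection.fixedPoints_eq (hB : IsBisection B) : fixedPoints B = s '' (B ∩ isotropy G) := by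
  ext x
  constructor
  · rintro ⟨⟨γ, hγ, rfl⟩, h⟩
    exact ⟨γ, ⟨hγ, h.symm.trans (bisectionMap_s hB hγ (Set.mem_image_of_mem s hγ))⟩, rfl⟩
  · rintro ⟨γ, ⟨hγ, h⟩, rfl⟩
    exact ⟨Set.mem_image_of_mem s hγ, (bisectionMap_s hB hγ _).trans h.symm⟩

variable [IsEtale G]

lemma isBisection_of_injOn (hB : IsOpen B) (hs : B.InjOn s) (hr : B.InjOn r) : IsBisection B :=
  ⟨(IsOpenEmbedding.of_continuous_injective_isOpenMap (continuous_s.comp continuous_subtype_val)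
      hs.injective (isOpenMap_s.comp hB.isOpenMap_subtype_val)).isEmbedding,
    (IsOpenEmbedding.of_continuous_injective_isOpenMap (continuous_r.comp continuous_subtype_val)
      hr.injective (isOpenMap_r.comp hB.isOpenMap_subtype_val)).isEmbedding⟩

lemma IsBisection.mono (hB : IsBisection B) (hC : IsOpen C) (hCB : C ⊆ B) : IsBisection C :=
  isBisection_of_injOn hC (hB.injOn_s.mono hCB) (hB.injOn_r.mono hCB)

lemma exists_isOpen_isBisection (γ : G) : ∃ U : Set G, IsOpen U ∧ γ ∈ U ∧ IsBisection U := by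
  obtain ⟨e, he, hs⟩ := isLocalHomeomorph_s (G := G) γ
  obtain ⟨e', he', hr⟩ := IsEtale.isLocalHomeomorph_r (G := G) γ
  have hopen : IsOpen (e.source ∩ e'.source) := e.open_source.inter e'.open_source
  refine ⟨_, hopen, ⟨he, he'⟩, isBisection_of_injOn hopen ?_ ?_⟩
  · rw [hs]; exact e.injOn.mono Set.inter_subset_left
  · rw [hr]; exact e'.injOn.mono Set.inter_subset_right

lemma IsBisection.measurableSet_fixedPoints [T2Space G] [MeasurableSpace (unitSpace G)]
    [BorelSpace (unitSpace G)] (hB : IsBisection B) (hBo : IsOpen B) :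
    MeasurableSet (fixedPoints B) := by
  have hdiff : fixedPoints B = s '' B \ s '' (B \ isotropy G) := by
    rw [hB.fixedPoints_eq, ← hB.injOn_s.image_sdiff_subset Set.sdiff_subset,
      Set.sdiff_sdiff_right_self]
  rw [hdiff]
  exact (isOpenMap_s _ hBo).measurableSet.diff
    (isOpenMap_s _ (hBo.sdiff isClosed_isotropy)).measurableSet

end Bisection

section UnitFunctions
variable {G : Type*} [TopologicalSpace G] [T2Space G] [ArrowGroupoid G] [IsEtale G]

/-- `f ∈ C_c(G⁰)`, extended by zero, as an element of `C_c(G)`. -/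
def unitConv (f : C_c(unitSpace G, ℂ)) : ConvAlg G :=
  ⟨⟨extendZero f, continuous_extendZero f.continuous⟩,
    HasCompactSupport.intro (f.hasCompactSupport.isCompact.image continuous_subtype_val)
      fun γ hγ => by
        by_cases h : γ ∈ unitSpace G
        · exact (extendZero_coe f ⟨γ, h⟩).trans
            (image_eq_zero_of_notMem_tsupport fun h' => hγ ⟨_, h', rfl⟩)
        · exact extendZero_of_notMem _ h⟩

lemma unitConv_coe (f : C_c(unitSpace G, ℂ)) (x : unitSpace G) : unitConv f x = f x :=
  extendZero_coe f x

lemma unitConv_of_notMem (f : C_c(unitSpace G, ℂ)) {γ : G} (h : γ ∉ unitSpace G) :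
    unitConv f γ = 0 := extendZero_of_notMem f h

lemma mul_unitConv (f : ConvAlg G) (h : C_c(unitSpace G, ℂ)) (γ : G) :
    (f * unitConv h) γ = f γ * h (s γ) := by
  rw [ConvAlg.mul_apply, tsum_eq_single ⟨s γ, s_unit _⟩]
  · rw [unitConv_coe, inv_unit]
    exact congrArg (fun η => f η * h (s γ)) (mul_src γ)
  · intro α hα
    rw [unitConv_of_notMem, mul_zero]
    exact fun hu => hα (Subtype.ext ((show src (α : G) = α from hu).symm.trans (s_eq_coe.1 α.2)))

lemma unitConv_mul (h : C_c(unitSpace G, ℂ)) (f : ConvAlg G) (γ : G) :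
    (unitConv h * f) γ = h (r γ) * f γ := by
  rw [ConvAlg.mul_apply, tsum_eq_single ⟨γ, rfl⟩]
  · rw [mul_inv_self]
    exact congrArg (· * f γ) (unitConv_coe h (r γ))
  · intro α hα
    rw [unitConv_of_notMem, zero_mul]
    exact fun hu => hα (Subtype.ext (eq_of_mul_inv_mem_unitSpace α.2.symm hu).symm)

lemma unitConv_mul_unitConv (g h : C_c(unitSpace G, ℂ)) :
    unitConv g * unitConv h = unitConv (g * h) := by
  ext γ
  rw [mul_unitConv]
  by_cases hγ : γ ∈ unitSpace G
  · lift γ to unitSpace G using hγ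
    simp only [unitConv_coe, s_unit, CompactlySupportedContinuousMap.mul_apply]
  · simp only [unitConv_of_notMem _ hγ, zero_mul]

lemma star_unitConv (h : C_c(unitSpace G, ℂ)) : star (unitConv h) = unitConv (star h) := by
  ext γ
  rw [ConvAlg.star_apply]
  by_cases hγ : γ ∈ unitSpace G
  · lift γ to unitSpace G using hγ
    simp only [inv_unit, unitConv_coe, CompactlySupportedContinuousMap.star_apply,
      starRingEnd_apply]
  · rw [unitConv_of_notMem _ hγ, unitConv_of_notMem _ (inv_mem_unitSpace.not.2 hγ), map_zero]

/-- The restriction of `f ∈ C_c(G)` to the closed set `G⁰`. -/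
def ConvAlg.restrictUnits (f : ConvAlg G) : C_c(unitSpace G, ℂ) :=
  ⟨⟨fun x => f x, f.continuous.comp continuous_subtype_val⟩,
    f.hasCompactSupport.comp_isClosedEmbedding isClosed_unitSpace.isClosedEmbedding_subtypeVal⟩

lemma ConvAlg.unitConv_restrictUnits {f : ConvAlg G} (hf : ∀ γ ∉ unitSpace G, f γ = 0) :
    unitConv f.restrictUnits = f := by
  ext γ
  by_cases hγ : γ ∈ unitSpace G
  · exact unitConv_coe f.restrictUnits ⟨γ, hγ⟩
  · rw [unitConv_of_notMem _ hγ, hf γ hγ]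

end UnitFunctions

section Reduced
variable {G : Type*} [TopologicalSpace G] [T2Space G] [ArrowGroupoid G] [IsEtale G]

lemma toReduced_zero : toReduced G (0 : ConvAlg G) = 0 := Subtype.ext (map_zero (regularSum G))

lemma toReduced_add (f g : ConvAlg G) : toReduced G (f + g) = toReduced G f + toReduced G g :=
  Subtype.ext (map_add (regularSum G) f g)

lemma toReduced_sub (f g : ConvAlg G) : toReduced G (f - g) = toReduced G f - toReduced G g :=
  Subtype.ext (map_sub (regularSum G) f g)

lemma toReduced_mul (f g : ConvAlg G) : toReduced G (f * g) = toReduced G f * toReduced G g :=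
  Subtype.ext (map_mul (regularSum G) f g)

lemma toReduced_star (f : ConvAlg G) : toReduced G (star f) = star (toReduced G f) :=
  Subtype.ext (map_star (regularSum G) f)

lemma denseRange_toReduced : DenseRange (toReduced G) := by
  intro a
  have hrange : Subtype.val '' Set.range (toReduced G) = Set.range (regularSum G) :=
    (Set.range_comp _ _).symm
  rw [closure_subtype, hrange]
  exact a.2

/-- The inclusion `C_c(G⁰) ⊆ C_0(G⁰)`. -/
def toC0 (f : C_c(unitSpace G, ℂ)) : C₀(unitSpace G, ℂ) :=
  ⟨f.toContinuousMap, f.hasCompactSupport.is_zero_at_infty⟩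

lemma toReduced_unitConv (f : C_c(unitSpace G, ℂ)) :
    toReduced G (unitConv f) = unitInclusion (toC0 f) := rfl

lemma denseRange_toC0 : DenseRange (toC0 (G := G)) := by
  intro f
  rw [Metric.mem_closure_range_iff]
  intro ε hε
  obtain ⟨g, d, hd, hgd⟩ := exists_approx f (ε := ε / 4) (by positivity)
  refine ⟨g.restrictUnits, lt_of_le_of_lt (b := 2 * (ε / 4)) ?_ (by linarith)⟩
  rw [← ZeroAtInftyContinuousMap.dist_toBCF_eq_dist,
    BoundedContinuousFunction.dist_le (by positivity)]
  intro x
  have hfg : f x - g x = d x := by simpa only [extendZero_coe] using hgd x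
  rw [dist_eq_norm]
  exact hfg ▸ hd x

lemma coord_unitInclusion_delta (f : C₀(unitSpace G, ℂ)) {x : unitSpace G} (γ α : fiber x) :
    (unitInclusion f).1.coord x (delta α) γ = extendZero f ((γ : G) * (α : G)⁻¹) :=
  regularOp_delta _ _ (iNorm_extendZero_ne_top f) _ _

lemma unitInclusion_sub (f g : C₀(unitSpace G, ℂ)) :
    unitInclusion (f - g) = unitInclusion f - unitInclusion g := by
  refine Subtype.ext (RegularProduct.ext fun x => op_ext fun γ α => ?_)
  change _ = (unitInclusion f).1.coord x (delta α) γ - (unitInclusion g).1.coord x (delta α) γ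
  simp only [coord_unitInclusion_delta]
  by_cases h : (γ * (α : G)⁻¹ : G) ∈ unitSpace G
  · lift (γ * (α : G)⁻¹ : G) to unitSpace G using h with u
    simp only [extendZero_coe, ZeroAtInftyContinuousMap.sub_apply]
  · simp only [extendZero_of_notMem _ h, sub_zero]

lemma norm_unitInclusion_le (f : C₀(unitSpace G, ℂ)) : ‖unitInclusion f‖ ≤ ‖f‖ := by
  refine RegularProduct.norm_le (norm_nonneg f) fun x => ?_
  rw [← enorm_le_iff_norm_le]
  refine (regularOp_enorm_le x _ (iNorm_extendZero_ne_top f)).trans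
    (iNorm_extendZero_le f _ fun y => ?_)
  rw [enorm_le_iff_norm_le, ← ZeroAtInftyContinuousMap.norm_toBCF_eq_norm]
  exact f.toBCF.norm_coe_le_norm y

lemma continuous_unitInclusion : Continuous (unitInclusion (G := G)) := by
  refine (LipschitzWith.mk_one fun f g => ?_).continuous
  rw [dist_eq_norm, dist_eq_norm, ← unitInclusion_sub]
  exact norm_unitInclusion_le (f - g)

/-- The representation `λ_x` of `C*_r(G)` on `ℓ²(G_x)`. -/
def reducedCoord (x : unitSpace G) :
    ReducedCStar G →⋆ₙₐ[ℂ] (ℓ²(fiber x, ℂ) →L[ℂ] ℓ²(fiber x, ℂ)) where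
  toFun a := a.1.coord x
  map_smul' _ _ := rfl
  map_zero' := rfl
  map_add' _ _ := rfl
  map_mul' _ _ := rfl
  map_star' _ := rfl

lemma unitExpectation_toReduced (f : ConvAlg G) (u : unitSpace G) :
    unitExpectation (toReduced G f) u = f u := by
  rw [unitExpectation, inner_delta_left]
  refine (regOp_delta u f _ _).trans ?_
  change f ((u : G) * (u : G)⁻¹) = _
  rw [mul_inv_self, rng_unit]

end Reduced

section PositiveFunctionals

section CauchySchwarz
variable {A : Type*} [NonUnitalRing A] [StarRing A] [Module ℂ A] [StarModule ℂ A]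
  [IsScalarTower ℂ A A] [SMulCommClass ℂ A A] {τ : A →ₗ[ℂ] ℂ}

lemma conj_apply_star_mul (hτ : ∀ a, 0 ≤ τ (star a * a)) (a b : A) :
    starRingEnd ℂ (τ (star b * a)) = τ (star a * b) := by
  have him : ∀ a, (τ (star a * a)).im = 0 := fun a => (Complex.nonneg_iff.1 (hτ a)).2.symm
  -- Polarization: the imaginary parts of `τ(c*c)` vanish for `c = a + b` and `c = a + ib`.
  have hadd := him (a + b)
  have hadd_I := him (a + Complex.I • b)
  simp only [star_add, add_mul, mul_add, map_add, Complex.add_im, him, star_smul,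
    smul_mul_assoc, mul_smul_comm, map_smul, smul_eq_mul, Complex.mul_im, Complex.I_re,
    Complex.I_im, Complex.star_def, Complex.conj_I, Complex.neg_re, Complex.neg_im,
    Complex.mul_re] at hadd hadd_I
  refine Complex.ext ?_ ?_
  · rw [Complex.conj_re]; linarith
  · rw [Complex.conj_im]; linarith

lemma sq_norm_apply_star_mul_le (hτ : ∀ a, 0 ≤ τ (star a * a)) (a b : A) :
    ‖τ (star a * b)‖ ^ 2 ≤ (τ (star a * a)).re * (τ (star b * b)).re := by
  let core : PreInnerProductSpace.Core ℂ A :=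
    { inner := fun a b => τ (star a * b)
      conj_inner_symm := conj_apply_star_mul hτ
      re_inner_nonneg := fun a => (Complex.nonneg_iff.1 (hτ a)).1
      add_left := fun a b c => by rw [star_add, add_mul, map_add]
      smul_left := fun a b c => by rw [star_smul, smul_mul_assoc, map_smul]; rfl }
  have h : ‖τ (star a * b)‖ * ‖τ (star b * a)‖ ≤ (τ (star a * a)).re * (τ (star b * b)).re :=
    @InnerProductSpace.Core.inner_mul_inner_self_le ℂ A _ _ _ core a b
  rwa [← conj_apply_star_mul hτ b a, RCLike.norm_conj, ← sq] at h

end CauchySchwarz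

section VectorFunctional
variable {A H : Type*} [NonUnitalCStarAlgebra A] [NormedAddCommGroup H] [InnerProductSpace ℂ H]
  [CompleteSpace H] (Φ : A →⋆ₙₐ[ℂ] (H →L[ℂ] H)) (ξ : H)

/-- The functional `a ↦ ⟨Φ(a) ξ, ξ⟩` of a representation `Φ` and a vector `ξ`. -/
def vectorFunctional : A →L[ℂ] ℂ :=
  LinearMap.mkContinuous
    { toFun := fun a => inner ℂ ξ (Φ a ξ)
      map_add' := fun a b => by rw [map_add, _root_.add_apply, inner_add_right]
      map_smul' := fun c a => by rw [map_smul, _root_.smul_apply, inner_smul_right]; rfl }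
    (‖ξ‖ * ‖ξ‖) fun a => by
      calc ‖inner ℂ ξ (Φ a ξ)‖ ≤ ‖ξ‖ * ‖Φ a ξ‖ := norm_inner_le_norm _ _
        _ ≤ ‖ξ‖ * (‖a‖ * ‖ξ‖) := by
          gcongr
          exact (Φ a).le_of_opNorm_le (NonUnitalStarAlgHom.norm_apply_le Φ a) ξ
        _ = ‖ξ‖ * ‖ξ‖ * ‖a‖ := by ring

lemma vectorFunctional_apply (a : A) : vectorFunctional Φ ξ a = inner ℂ ξ (Φ a ξ) := rfl

lemma norm_vectorFunctional_le : ‖vectorFunctional Φ ξ‖ ≤ ‖ξ‖ * ‖ξ‖ :=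
  LinearMap.mkContinuous_norm_le _ (by positivity) _

lemma vectorFunctional_nonneg (a : A) : 0 ≤ vectorFunctional Φ ξ (star a * a) := by
  rw [vectorFunctional_apply, map_mul, map_star, mul_apply_eq_comp,
    ContinuousLinearMap.star_eq_adjoint, ContinuousLinearMap.adjoint_inner_right]
  rw [← inner_self_ofReal_norm]
  exact RCLike.ofReal_nonneg.2 (norm_nonneg _)

end VectorFunctional

section Integral
variable {X E : Type*} [MeasurableSpace X] [NormedAddCommGroup E] [NormedSpace ℂ E]
  {φ : X → E →L[ℂ] ℂ}

lemma measurable_apply_of_denseRange {ι : Type*} {j : ι → E} (hj : DenseRange j)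
    (h : ∀ i, Measurable fun x => φ x (j i)) (a : E) : Measurable fun x => φ x a := by
  obtain ⟨u, hu, hlim⟩ := mem_closure_iff_seq_limit.1 (hj a)
  refine measurable_of_tendsto_metrizable (f := fun n x => φ x (u n)) (fun n => ?_) ?_
  · obtain ⟨i, hi⟩ := hu n
    simpa only [hi] using h i
  · exact tendsto_pi_nhds.2 fun x => ((φ x).continuous.tendsto a).comp hlim

variable {C : ℝ} (μ : Measure X) [IsFiniteMeasure μ]

lemma integrable_apply (hm : ∀ a, Measurable fun x => φ x a) (hb : ∀ x, ‖φ x‖ ≤ C) (a : E) :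
    Integrable (fun x => φ x a) μ :=
  Integrable.of_bound (hm a).aestronglyMeasurable (C * ‖a‖)
    (Eventually.of_forall fun x => (φ x).le_of_opNorm_le (hb x) a)

/-- The functional `∫ φ_x dμ(x)`, for a bounded, weakly measurable family of functionals `φ_x`. -/
def integralFunctional (φ : X → E →L[ℂ] ℂ) (hm : ∀ a, Measurable fun x => φ x a)
    (hb : ∀ x, ‖φ x‖ ≤ C) : E →L[ℂ] ℂ :=
  LinearMap.mkContinuous
    { toFun := fun a => ∫ x, φ x a ∂μ
      map_add' := fun a b => by
        simp only [map_add]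
        exact integral_add (integrable_apply μ hm hb a) (integrable_apply μ hm hb b)
      map_smul' := fun c a => by
        simp only [map_smul]
        exact integral_smul c _ }
    (C * μ.real Set.univ) fun a => by
      calc ‖∫ x, φ x a ∂μ‖ ≤ C * ‖a‖ * μ.real Set.univ :=
            norm_integral_le_of_norm_le_const
              (Eventually.of_forall fun x => (φ x).le_of_opNorm_le (hb x) a)
        _ = C * μ.real Set.univ * ‖a‖ := by ring

lemma integralFunctional_apply (hm : ∀ a, Measurable fun x => φ x a) (hb : ∀ x, ‖φ x‖ ≤ C)
    (a : E) : integralFunctional μ φ hm hb a = ∫ x, φ x a ∂μ := rfl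

lemma norm_integralFunctional_le (hC : 0 ≤ C) (hm : ∀ a, Measurable fun x => φ x a)
    (hb : ∀ x, ‖φ x‖ ≤ C) : ‖integralFunctional μ φ hm hb‖ ≤ C * μ.real Set.univ :=
  LinearMap.mkContinuous_norm_le _ (by positivity) _

end Integral

end PositiveFunctionals

section Canonical
variable {G : Type*} [TopologicalSpace G] [T2Space G] [ArrowGroupoid G] [IsEtale G]

lemma norm_delta {ι : Type*} (j : ι) : ‖(delta j : ℓ²(ι, ℂ))‖ = 1 := by
  classical
  rw [delta, lp.norm_single (by norm_num), norm_one]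

/-- The functional `a ↦ E(a)(x)`. -/
def expectationAt (x : unitSpace G) : ReducedCStar G →L[ℂ] ℂ :=
  vectorFunctional (reducedCoord x) (delta ⟨x, s_unit x⟩)

lemma norm_expectationAt_le (x : unitSpace G) : ‖expectationAt x‖ ≤ 1 := by
  refine (norm_vectorFunctional_le _ _).trans ?_
  rw [norm_delta, one_mul]

lemma expectationAt_toReduced (x : unitSpace G) (f : ConvAlg G) :
    expectationAt x (toReduced G f) = f x := unitExpectation_toReduced f x

section CanonicalTrace
variable [MeasurableSpace (unitSpace G)]

lemma traceOf_toReduced (μ : Measure (unitSpace G)) (f : ConvAlg G) :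
    traceOf μ (toReduced G f) = ∫ x : unitSpace G, f x ∂μ := by
  simp only [traceOf, unitExpectation_toReduced]

variable [BorelSpace (unitSpace G)]

lemma measurable_expectationAt (a : ReducedCStar G) : Measurable fun x => expectationAt x a := by
  refine measurable_apply_of_denseRange denseRange_toReduced (fun f => ?_) a
  simp only [expectationAt_toReduced]
  exact (f.continuous.comp continuous_subtype_val).measurable

/-- The functional `τ_μ : a ↦ ∫ E(a) dμ`. -/
def canonicalTrace (μ : Measure (unitSpace G)) [IsFiniteMeasure μ] : ReducedCStar G →L[ℂ] ℂ :=
  integralFunctional μ expectationAt measurable_expectationAt norm_expectationAt_le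

lemma canonicalTrace_apply (μ : Measure (unitSpace G)) [IsFiniteMeasure μ] (a : ReducedCStar G) :
    canonicalTrace μ a = traceOf μ a := rfl

end CanonicalTrace

section Vanishing
variable [LocallyCompactSpace G] {τ : ReducedCStar G →L[ℂ] ℂ}

instance : LocallyCompactSpace (unitSpace G) := isClosed_unitSpace.locallyCompactSpace

lemma exists_mul_unitConv_eq_self_and_unitConv_mul_eq_zero {f : ConvAlg G}
    {V W : Set (unitSpace G)} (hV : IsOpen V) (hVW : Disjoint V W)
    (hfV : s '' tsupport f ⊆ V) (hfW : r '' tsupport f ⊆ W) :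
    ∃ h : C_c(unitSpace G, ℂ), f * unitConv h = f ∧ unitConv h * f = 0 := by
  obtain ⟨χ, hχ, hχV, -⟩ := exists_cutoff (f.hasCompactSupport.isCompact.image continuous_s) hV hfV
  refine ⟨toComplex χ, ?_, ?_⟩ <;> ext γ <;> by_cases hγ : γ ∈ tsupport f
  · rw [mul_unitConv, toComplex_apply, hχ ⟨γ, hγ, rfl⟩, Pi.one_apply, Complex.ofReal_one, mul_one]
  · rw [mul_unitConv, image_eq_zero_of_notMem_tsupport hγ, zero_mul]
  · have hrγ : r γ ∉ tsupport χ := fun h => Set.disjoint_left.1 hVW (hχV h) (hfW ⟨γ, hγ, rfl⟩)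
    rw [unitConv_mul, toComplex_apply, image_eq_zero_of_notMem_tsupport hrγ, Complex.ofReal_zero,
      zero_mul, ConvAlg.zero_apply]
  · rw [unitConv_mul, image_eq_zero_of_notMem_tsupport hγ, mul_zero, ConvAlg.zero_apply]

lemma apply_toReduced_eq_zero_of_disjoint_isotropy (hτ : ∀ a b, τ (a * b) = τ (b * a))
    (f : ConvAlg G) (hf : Disjoint (tsupport f) (isotropy G)) : τ (toReduced G f) = 0 := by
  refine ConvAlg.local_induction (P := fun f => τ (toReduced G f) = 0) ?_ ?_ f fun γ hγ => ?_
  · rw [toReduced_zero, map_zero]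
  · intro f g hf hg
    rw [toReduced_add, map_add, hf, hg, add_zero]
  obtain ⟨V, W, hV, hW, hsV, hrW, hVW⟩ := t2_separation (Set.disjoint_left.1 hf hγ)
  refine ⟨s ⁻¹' V ∩ r ⁻¹' W, (hV.preimage continuous_s).inter (hW.preimage continuous_r),
    ⟨hsV, hrW⟩, fun g hg => ?_⟩
  obtain ⟨h, hgh, hhg⟩ := exists_mul_unitConv_eq_self_and_unitConv_mul_eq_zero (f := g) hV hVW
    (Set.image_subset_iff.2 fun η hη => (hg hη).1) (Set.image_subset_iff.2 fun η hη => (hg hη).2)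
  rw [← hgh, toReduced_mul, hτ, ← toReduced_mul, hhg, toReduced_zero, map_zero]

lemma apply_toReduced_mul_unitConv (hτ : ∀ a b, τ (a * b) = τ (b * a)) (f : ConvAlg G)
    (h : C_c(unitSpace G, ℂ)) (hh : ∀ x ∈ s '' (tsupport f ∩ isotropy G), ∀ᶠ y in 𝓝 x, h y = 1) :
    τ (toReduced G (f * unitConv h)) = τ (toReduced G f) := by
  have hsub (γ : G) : (f * unitConv h - f) γ = f γ * (h (s γ) - 1) := by
    rw [show (f * unitConv h - f) γ = (f * unitConv h) γ - f γ from rfl, mul_unitConv]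
    ring
  rw [← sub_eq_zero, ← map_sub, ← toReduced_sub]
  refine apply_toReduced_eq_zero_of_disjoint_isotropy hτ _ (Set.disjoint_left.2 fun γ hγ hiso => ?_)
  have hγf : γ ∈ tsupport f :=
    closure_mono (Function.support_subset_iff'.2 fun η h0 => by
      rw [hsub, Function.notMem_support.1 h0, zero_mul]) hγ
  refine notMem_tsupport_iff_eventuallyEq.2 ?_ hγ
  filter_upwards [continuous_s.continuousAt.eventually (hh _ ⟨γ, ⟨hγf, hiso⟩, rfl⟩)] with η hη
  rw [hsub, hη, sub_self, mul_zero, Pi.zero_apply]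

end Vanishing

section AssociatedMeasure

lemma re_apply_toReduced_mul_star_nonneg {τ : ReducedCStar G →L[ℂ] ℂ}
    (hτ : ∀ a, 0 ≤ τ (star a * a)) (f : ConvAlg G) :
    0 ≤ (τ (toReduced G (f * star f))).re := by
  rw [toReduced_mul, toReduced_star]
  simpa only [star_star] using (Complex.nonneg_iff.1 (hτ (star (toReduced G f)))).1

variable [MeasurableSpace (unitSpace G)] {μ : Measure (unitSpace G)}
  {τ : ReducedCStar G →L[ℂ] ℂ}

lemma IsAssociatedMeasure.sq_norm_apply_mul_unitConv_le (hμ : IsAssociatedMeasure τ μ)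
    (hτ : ∀ a, 0 ≤ τ (star a * a)) (f : ConvAlg G) (h : C_c(unitSpace G, ℂ)) :
    ‖τ (toReduced G (f * unitConv h))‖ ^ 2 ≤
      (τ (toReduced G (f * star f))).re * ∫ x, ‖h x‖ ^ 2 ∂μ := by
  have hint : τ (star (toReduced G (unitConv h)) * toReduced G (unitConv h)) =
      ((∫ x, ‖h x‖ ^ 2 ∂μ : ℝ) : ℂ) := by
    rw [← toReduced_star, ← toReduced_mul, star_unitConv, unitConv_mul_unitConv,
      toReduced_unitConv, hμ, ← integral_complex_ofReal]
    refine integral_congr_ae (Eventually.of_forall fun x => ?_)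
    exact (RCLike.conj_mul (h x)).trans (by norm_cast)
  have hCS := sq_norm_apply_star_mul_le (τ := (τ : ReducedCStar G →ₗ[ℂ] ℂ)) hτ
    (star (toReduced G f)) (toReduced G (unitConv h))
  simp only [ContinuousLinearMap.coe_coe, star_star, hint, Complex.ofReal_re] at hCS
  rwa [← toReduced_star, ← toReduced_mul, ← toReduced_mul] at hCS

variable [LocallyCompactSpace G]

lemma IsEssentiallyFree.exists_isOpen_isotropy_null (hfree : IsEssentiallyFree μ) {γ : G}
    (hγ : γ ∉ unitSpace G) : ∃ U : Set G, IsOpen U ∧ γ ∈ U ∧ U ⊆ (unitSpace G)ᶜ ∧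
      μ (s '' (U ∩ isotropy G)) = 0 := by
  obtain ⟨U, hU, hγU, hUb⟩ := exists_isOpen_isBisection γ
  obtain ⟨K, hK, hγK, hKU⟩ := exists_compact_subset (hU.inter isClosed_unitSpace.isOpen_compl)
    (show γ ∈ U ∩ (unitSpace G)ᶜ from ⟨hγU, hγ⟩)
  obtain ⟨hintU, hintunit⟩ := Set.subset_inter_iff.1 (interior_subset.trans hKU)
  have hb : IsBisection (interior K) := hUb.mono isOpen_interior hintU
  refine ⟨interior K, isOpen_interior, hγK, hintunit, ?_⟩
  rw [← hb.fixedPoints_eq]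
  exact hfree _ isOpen_interior hb (hK.closure_of_subset interior_subset) hintunit

variable [BorelSpace (unitSpace G)]

lemma IsAssociatedMeasure.sq_norm_apply_le_of_isOpen [IsFiniteMeasure μ]
    (hμ : IsAssociatedMeasure τ μ) (hτ : IsTracialState τ) (f : ConvAlg G)
    {V : Set (unitSpace G)} (hV : IsOpen V) (hfV : s '' (tsupport f ∩ isotropy G) ⊆ V) :
    ‖τ (toReduced G f)‖ ^ 2 ≤ (τ (toReduced G (f * star f))).re * μ.real V := by
  have hcompact : IsCompact (s '' (tsupport f ∩ isotropy G)) :=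
    (f.hasCompactSupport.isCompact.inter_right isClosed_isotropy).image continuous_s
  obtain ⟨K, hK, hfK, hKV⟩ := exists_compact_between hcompact hV hfV
  obtain ⟨χ, hχ, hχV, hχ01⟩ := exists_cutoff hK hV hKV
  have hχ_nhds : ∀ x ∈ s '' (tsupport f ∩ isotropy G), ∀ᶠ y in 𝓝 x, toComplex χ y = 1 :=
    fun x hx => mem_of_superset (isOpen_interior.mem_nhds (hfK hx)) fun y hy => by
      simp [hχ (interior_subset hy)]
  have hint : ∫ x, ‖toComplex χ x‖ ^ 2 ∂μ ≤ μ.real V := by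
    rw [← integral_indicator_one hV.measurableSet]
    refine integral_mono_of_nonneg (Eventually.of_forall fun x => sq_nonneg _)
      ((integrable_const 1).indicator hV.measurableSet) (Eventually.of_forall fun x => ?_)
    by_cases hx : x ∈ V
    · simpa [Set.indicator_of_mem hx, abs_of_nonneg (hχ01 x).1] using
        (hχ01 x).2
    · simp [Set.indicator_of_notMem hx, image_eq_zero_of_notMem_tsupport fun h => hx (hχV h)]
  have hpos := re_apply_toReduced_mul_star_nonneg hτ.nonneg f
  calc ‖τ (toReduced G f)‖ ^ 2
      = ‖τ (toReduced G (f * unitConv (toComplex χ)))‖ ^ 2 := by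
        rw [apply_toReduced_mul_unitConv hτ.tracial f _ hχ_nhds]
    _ ≤ (τ (toReduced G (f * star f))).re * ∫ x, ‖toComplex χ x‖ ^ 2 ∂μ :=
        hμ.sq_norm_apply_mul_unitConv_le hτ.nonneg f _
    _ ≤ (τ (toReduced G (f * star f))).re * μ.real V := by gcongr

lemma IsAssociatedMeasure.apply_eq_zero_of_isotropy_null [IsFiniteMeasure μ] [μ.OuterRegular]
    (hμ : IsAssociatedMeasure τ μ) (hτ : IsTracialState τ) (f : ConvAlg G)
    (hf : μ (s '' (tsupport f ∩ isotropy G)) = 0) :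
    τ (toReduced G f) = 0 := by
  set M := (τ (toReduced G (f * star f))).re
  have hM : 0 ≤ M := re_apply_toReduced_mul_star_nonneg hτ.nonneg f
  have hbound : ∀ᶠ ε in 𝓝[>] (0 : ℝ), ‖τ (toReduced G f)‖ ^ 2 ≤ M * ε := by
    filter_upwards [self_mem_nhdsWithin] with ε (hε : 0 < ε)
    obtain ⟨V, hfV, hV, hVε⟩ := Set.exists_isOpen_lt_of_lt _ (ENNReal.ofReal ε)
      (hf.trans_lt (ENNReal.ofReal_pos.2 hε))
    calc ‖τ (toReduced G f)‖ ^ 2 ≤ M * μ.real V := hμ.sq_norm_apply_le_of_isOpen hτ f hV hfV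
      _ ≤ M * ε := by
        gcongr
        exact ENNReal.toReal_le_of_le_ofReal hε.le hVε.le
  have hlim : Tendsto (fun ε => M * ε) (𝓝[>] 0) (𝓝 0) := by
    simpa only [mul_zero] using
      ((continuous_const_mul M).tendsto 0).mono_left nhdsWithin_le_nhds
  have hsq : ‖τ (toReduced G f)‖ ^ 2 ≤ 0 := ge_of_tendsto hlim hbound
  exact norm_eq_zero.1 (pow_eq_zero_iff two_ne_zero |>.1 (le_antisymm hsq (sq_nonneg _)))

theorem IsEssentiallyFree.isCanonical [IsProbabilityMeasure μ] [μ.Regular]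
    (hfree : IsEssentiallyFree μ) (hτ : IsTracialState τ) (hμ : IsAssociatedMeasure τ μ) :
    IsCanonical τ := by
  refine ⟨μ, inferInstance, inferInstance, hμ, congrFun <|
    denseRange_toReduced.equalizer τ.continuous (canonicalTrace μ).continuous <|
    funext fun f => ?_⟩
  refine ConvAlg.local_induction
    (P := fun f => τ (toReduced G f) = canonicalTrace μ (toReduced G f)) ?_ ?_ f fun γ _ => ?_
  · rw [toReduced_zero, map_zero, map_zero]
  · intro f g hf hg
    rw [toReduced_add, map_add, map_add, hf, hg]
  simp only [canonicalTrace_apply, traceOf_toReduced]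
  by_cases hγ : γ ∈ unitSpace G
  · refine ⟨unitSpace G, isOpen_unitSpace, hγ, fun g hg => ?_⟩
    have hg0 : ∀ η ∉ unitSpace G, g η = 0 := fun η hη =>
      image_eq_zero_of_notMem_tsupport fun h => hη (hg h)
    rw [← ConvAlg.unitConv_restrictUnits hg0, toReduced_unitConv, hμ]
    simp only [unitConv_coe]
    rfl
  · obtain ⟨U, hU, hγU, hUunit, hUnull⟩ := hfree.exists_isOpen_isotropy_null hγ
    refine ⟨U, hU, hγU, fun g hg => ?_⟩
    have hg0 (x : unitSpace G) : g x = 0 :=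
      image_eq_zero_of_notMem_tsupport fun h => hUunit (hg h) x.2
    have hnull : μ (s '' (tsupport g ∩ isotropy G)) = 0 :=
      measure_mono_null (Set.image_mono (Set.inter_subset_inter_left _ hg)) hUnull
    simp only [hμ.apply_eq_zero_of_isotropy_null hτ g hnull, hg0, integral_zero]

end AssociatedMeasure

end Canonical

section ArrowSum
variable {G : Type*} [ArrowGroupoid G]

/-- The sum of `f(γ)` over all arrows `γ` from `z` to `y`. -/
def arrowSum (f : G → ℂ) (y z : unitSpace G) : ℂ :=
  ∑' γ : G, Set.indicator {γ | s γ = z ∧ r γ = y} f γ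

lemma arrowSum_eq_tsum_fiber (f : G → ℂ) (y z : unitSpace G) :
    arrowSum f y z = ∑' γ : fiber z, (r ⁻¹' {y}).indicator f γ := by
  refine Eq.trans ?_ (tsum_subtype {γ | s γ = z} ((r ⁻¹' {y}).indicator f)).symm
  simp only [Set.indicator_indicator]
  rfl

lemma arrowSum_eq_zero {f : G → ℂ} {y z : unitSpace G} (h : ∀ γ, s γ = z → r γ = y → f γ = 0) :
    arrowSum f y z = 0 := by
  rw [arrowSum, ← tsum_zero (α := ℂ) (β := G)]
  exact tsum_congr fun γ => Set.indicator_apply_eq_zero.2 fun hγ => h γ hγ.1 hγ.2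

lemma arrowSum_of_injOn {f : G → ℂ} {U : Set G} (hf : ∀ γ ∉ U, f γ = 0) (hU : U.InjOn s)
    {γ : G} (hγ : γ ∈ U) : arrowSum f (r γ) (s γ) = f γ := by
  rw [arrowSum, tsum_eq_single γ]
  · exact Set.indicator_of_mem (s := {η | s η = s γ ∧ r η = r γ}) ⟨rfl, rfl⟩ f
  · exact fun η hη => Set.indicator_apply_eq_zero.2 fun h => hf η fun hηU => hη (hU hηU hγ h.1)

lemma arrowSum_star (f : G → ℂ) (y z : unitSpace G) :
    arrowSum (fun γ => starRingEnd ℂ (f γ⁻¹)) y z = starRingEnd ℂ (arrowSum f z y) := by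
  let inv : G ≃ G := ⟨fun γ => γ⁻¹, fun γ => γ⁻¹, arrow_inv_inv, arrow_inv_inv⟩
  rw [arrowSum, arrowSum, Complex.conj_tsum, ← inv.tsum_eq]
  refine tsum_congr fun γ => ?_
  by_cases h : s γ = y ∧ r γ = z
  · rw [Set.indicator_of_mem (s := {γ | s γ = y ∧ r γ = z}) h,
      Set.indicator_of_mem (by simpa [inv, s_inv, r_inv, and_comm] using h)]
    exact congrArg (fun η => starRingEnd ℂ (f η)) (arrow_inv_inv γ)
  · rw [Set.indicator_of_notMem (s := {γ | s γ = y ∧ r γ = z}) h, map_zero,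
      Set.indicator_of_notMem (by simpa [inv, s_inv, r_inv, and_comm] using h)]

lemma tsum_enorm_arrowSum_le_tsum_fiber (f : G → ℂ) (z : unitSpace G) :
    ∑' y, ‖arrowSum f y z‖ₑ ≤ ∑' γ : fiber z, ‖f γ‖ₑ := by
  calc ∑' y, ‖arrowSum f y z‖ₑ
      ≤ ∑' y, ∑' γ : fiber z, ‖(r ⁻¹' {y}).indicator f γ‖ₑ := by
        gcongr with y
        rw [arrowSum_eq_tsum_fiber]
        exact enorm_tsum_le_tsum_enorm
    _ = ∑' γ : fiber z, ∑' y, ‖(r ⁻¹' {y}).indicator f γ‖ₑ := ENNReal.tsum_comm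
    _ = ∑' γ : fiber z, ‖f γ‖ₑ := tsum_congr fun γ => by
        rw [tsum_eq_single (r (γ : G)) fun y hy => by
          rw [Set.indicator_of_notMem fun h => hy h.symm, enorm_zero],
          Set.indicator_of_mem (by rfl)]

lemma tsum_enorm_arrowSum_source_le (f : G → ℂ) (z : unitSpace G) :
    ∑' y, ‖arrowSum f y z‖ₑ ≤ iNorm f :=
  (tsum_enorm_arrowSum_le_tsum_fiber f z).trans
    ((le_iSup (fun x : unitSpace G => ∑' γ : fiber x, ‖f γ‖ₑ) z).trans (le_max_left _ _))

lemma tsum_enorm_arrowSum_range_le (f : G → ℂ) (y : unitSpace G) :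
    ∑' z, ‖arrowSum f y z‖ₑ ≤ iNorm f := by
  have hstar (z : unitSpace G) :
      ‖arrowSum f y z‖ₑ = ‖arrowSum (fun γ => starRingEnd ℂ (f γ⁻¹)) z y‖ₑ := by
    rw [arrowSum_star, RCLike.enorm_conj]
  simp only [hstar]
  exact (tsum_enorm_arrowSum_le_tsum_fiber _ y).trans
    ((le_iSup (fun x : unitSpace G => ∑' γ : fiber x, ‖starRingEnd ℂ (f (γ : G)⁻¹)‖ₑ) y).trans
      (le_max_right _ _))

lemma arrowSum_smul (c : ℂ) (f : G → ℂ) (y z : unitSpace G) :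
    arrowSum (c • f) y z = c * arrowSum f y z := by
  rw [arrowSum, arrowSum, ← tsum_mul_left]
  exact tsum_congr fun γ => Set.indicator_const_smul_apply _ c f γ

variable [TopologicalSpace G] [IsEtale G]

lemma ConvAlg.finite_support_fiber (f : ConvAlg G) (z : unitSpace G) :
    (Function.support fun γ : fiber z => f γ).Finite :=
  ((finite_fiber f.hasCompactSupport.isCompact z).preimage Subtype.val_injective.injOn).subset
    fun γ hγ => ⟨subset_tsupport _ hγ, γ.2⟩

lemma ConvAlg.summable_indicator_fiber (f : ConvAlg G) (y z : unitSpace G) :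
    Summable fun γ : fiber z => (r ⁻¹' {y}).indicator f γ :=
  summable_of_hasFiniteSupport <| (f.finite_support_fiber z).subset fun _ hγ h =>
    hγ (Set.indicator_apply_eq_zero.2 fun _ => h)

lemma arrowSum_add (f g : ConvAlg G) (y z : unitSpace G) :
    arrowSum (f + g : ConvAlg G) y z = arrowSum f y z + arrowSum g y z := by
  simp only [arrowSum_eq_tsum_fiber]
  rw [← (f.summable_indicator_fiber y z).tsum_add (g.summable_indicator_fiber y z)]
  exact tsum_congr fun γ => congrFun (Set.indicator_add _ f g) γ

lemma apply_le_arrowSum {f : ConvAlg G} (hf : ∀ γ, 0 ≤ f γ) (γ : G) :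
    f γ ≤ arrowSum f (r γ) (s γ) := by
  rw [arrowSum_eq_tsum_fiber]
  have hle := (f.summable_indicator_fiber (r γ) (s γ)).le_tsum ⟨γ, rfl⟩ fun η _ =>
    Set.indicator_nonneg (fun η _ => hf η) _
  rwa [Set.indicator_of_mem (by rfl)] at hle

lemma tsum_mul_arrowSum (φ : unitSpace G → ℂ) (g : ConvAlg G) (z : unitSpace G) :
    ∑' w, φ w * arrowSum g w z = ∑' α : fiber z, φ (r (α : G)) * g α := by
  set S := (g.finite_support_fiber z).toFinset
  have hS : ∀ α ∉ S, g (α : G) = 0 := fun α hα => by simpa [S] using hα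
  have hsingle (α : fiber z) : HasSum (fun w => φ w * (r ⁻¹' {w}).indicator g α)
      (φ (r (α : G)) * g α) := by
    have h := hasSum_single (f := fun w => φ w * (r ⁻¹' {w}).indicator g α) (r (α : G))
      fun w hw => by rw [Set.indicator_of_notMem fun h => hw h.symm, mul_zero]
    rwa [Set.indicator_of_mem (by rfl)] at h
  have hsum (w : unitSpace G) : φ w * arrowSum g w z =
      ∑ α ∈ S, φ w * (r ⁻¹' {w}).indicator g α := by
    rw [arrowSum_eq_tsum_fiber, tsum_eq_sum fun α hα =>
      Set.indicator_apply_eq_zero.2 fun _ => hS α hα, Finset.mul_sum]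
  simp only [hsum]
  rw [(hasSum_sum fun α _ => hsingle α).tsum_eq, tsum_eq_sum fun α hα => by rw [hS α hα, mul_zero]]

variable [T2Space G]

lemma indicator_mul_apply (f g : ConvAlg G) (y : unitSpace G) {z : unitSpace G} (γ : fiber z) :
    (r ⁻¹' {y}).indicator (f * g : ConvAlg G) γ =
      ∑' α : fiber z, (r ⁻¹' {y}).indicator f (fiberEquiv α γ) * g α := by
  obtain ⟨γ, rfl⟩ := γ
  have hr (α : fiber (s γ)) : r (fiberEquiv α ⟨γ, rfl⟩ : G) = r γ := r_mul_inv α.2.symm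
  by_cases h : r γ = y
  · rw [Set.indicator_of_mem (by exact h), ConvAlg.mul_apply]
    refine tsum_congr fun α => ?_
    rw [Set.indicator_of_mem (s := r ⁻¹' {y}) ((hr α).trans h)]
    rfl
  · rw [Set.indicator_of_notMem (by exact h), ← tsum_zero (α := ℂ) (β := fiber (s γ))]
    refine tsum_congr fun α => ?_
    rw [Set.indicator_of_notMem (s := r ⁻¹' {y}) fun h' => h ((hr α).symm.trans h'), zero_mul]

lemma arrowSum_mul_eq_tsum_fiber (f g : ConvAlg G) (y z : unitSpace G) :
    arrowSum (f * g : ConvAlg G) y z = ∑' α : fiber z, arrowSum f y (r (α : G)) * g α := by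
  set S := (g.finite_support_fiber z).toFinset
  have hS : ∀ α ∉ S, g (α : G) = 0 := fun α hα => by simpa [S] using hα
  have htranslate (α : fiber z) : HasSum
      (fun γ : fiber z => (r ⁻¹' {y}).indicator f (fiberEquiv α γ) * g α)
      (arrowSum f y (r (α : G)) * g α) := by
    rw [arrowSum_eq_tsum_fiber]
    exact ((fiberEquiv α).hasSum_iff.2
      (f.summable_indicator_fiber y (r (α : G))).hasSum).mul_right _
  have hsum (γ : fiber z) : (r ⁻¹' {y}).indicator (f * g : ConvAlg G) γ =
      ∑ α ∈ S, (r ⁻¹' {y}).indicator f (fiberEquiv α γ) * g α := by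
    rw [indicator_mul_apply, tsum_eq_sum fun α hα => by rw [hS α hα, mul_zero]]
  rw [arrowSum_eq_tsum_fiber]
  simp only [hsum]
  rw [(hasSum_sum fun α _ => htranslate α).tsum_eq,
    tsum_eq_sum fun α hα => by rw [hS α hα, mul_zero]]

lemma arrowSum_mul (f g : ConvAlg G) (y z : unitSpace G) :
    arrowSum (f * g : ConvAlg G) y z = ∑' w, arrowSum f y w * arrowSum g w z :=
  (arrowSum_mul_eq_tsum_fiber f g y z).trans (tsum_mul_arrowSum (arrowSum f y) g z).symm

end ArrowSum

section OrbitRepresentation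
variable {G : Type*} [TopologicalSpace G] [ArrowGroupoid G] [IsEtale G]

/-- The operator on `ℓ²(G⁰)` mapping `δ_x` to the sum of `f(γ) δ_{r(γ)}` over `γ ∈ G_x`. -/
def orbitOp (f : ConvAlg G) : ℓ²(unitSpace G, ℂ) →L[ℂ] ℓ²(unitSpace G, ℂ) :=
  kernelOp (arrowSum f) (iNorm f) f.iNorm_ne_top (tsum_enorm_arrowSum_range_le f)
    (tsum_enorm_arrowSum_source_le f)

lemma orbitOp_apply (f : ConvAlg G) (ξ : ℓ²(unitSpace G, ℂ)) (y : unitSpace G) :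
    orbitOp f ξ y = ∑' z, arrowSum f y z * ξ z := rfl

lemma orbitOp_delta (f : ConvAlg G) (y z : unitSpace G) :
    orbitOp f (delta z) y = arrowSum f y z := kernelOp_delta _ _ _ _ _ _ _

lemma enorm_orbitOp_le (f : ConvAlg G) : ‖orbitOp f‖ₑ ≤ iNorm f := kernelOp_enorm_le _ _ _ _ _

lemma orbitOp_add (f g : ConvAlg G) : orbitOp (f + g) = orbitOp f + orbitOp g :=
  op_ext fun y z => by
    rw [_root_.add_apply, lp.coeFn_add, Pi.add_apply]
    simp only [orbitOp_delta, arrowSum_add]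

lemma orbitOp_smul (c : ℂ) (f : ConvAlg G) : orbitOp (c • f) = c • orbitOp f :=
  op_ext fun y z => by
    rw [_root_.smul_apply, lp.coeFn_smul, Pi.smul_apply, orbitOp_delta, orbitOp_delta]
    exact arrowSum_smul c f y z

lemma orbitOp_star (f : ConvAlg G) : orbitOp (star f) = star (orbitOp f) := by
  refine op_ext fun y z => ?_
  rw [← inner_delta_left y (star (orbitOp f) (delta z)), ContinuousLinearMap.star_eq_adjoint,
    ContinuousLinearMap.adjoint_inner_right, inner_delta_right, orbitOp_delta, orbitOp_delta]
  exact arrowSum_star f y z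

variable [T2Space G]

lemma orbitOp_mul (f g : ConvAlg G) : orbitOp (f * g) = orbitOp f * orbitOp g :=
  op_ext fun y z => by
    simp only [mul_apply_eq_comp, orbitOp_delta, orbitOp_apply f (orbitOp g (delta z)),
      arrowSum_mul]

variable (G) in
/-- The representation of `C_c(G)` on `ℓ²(G⁰)`: the direct sum over the orbits of the
quasi-regular representations. -/
def orbitRep : ContractiveRep G where
  H := ℓ²(unitSpace G, ℂ)
  π :=
    { toFun := orbitOp
      map_smul' := orbitOp_smul
      map_zero' := by simpa only [zero_smul] using orbitOp_smul (0 : ℂ) (0 : ConvAlg G)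
      map_add' := orbitOp_add
      map_mul' := orbitOp_mul
      map_star' := orbitOp_star }
  contractive := enorm_orbitOp_le

variable (G) in
/-- The extension of `orbitRep` to `C*(G)`: the coordinate of `C*(G) ⊆ ∏_ρ B(H_ρ)` at
`orbitRep`. -/
def maximalOrbitRep : MaximalCStar G →⋆ₙₐ[ℂ] (ℓ²(unitSpace G, ℂ) →L[ℂ] ℓ²(unitSpace G, ℂ)) where
  toFun a := a.1.coord (orbitRep G)
  map_smul' _ _ := rfl
  map_zero' := rfl
  map_add' _ _ := rfl
  map_mul' _ _ := rfl
  map_star' _ := rfl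

/-- Under weak containment, the inverse of the canonical quotient map. -/
def WeakContainment.lift (hG : WeakContainment G) : ReducedCStar G →⋆ₙₐ[ℂ] MaximalCStar G :=
  ((StarAlgEquiv.ofBijective (canonicalQuotient G) hG).symm :
    ReducedCStar G →⋆ₙₐ[ℂ] MaximalCStar G)

lemma WeakContainment.lift_toReduced (hG : WeakContainment G) (f : ConvAlg G) :
    hG.lift (toReduced G f) = toMaximal G f :=
  (StarAlgEquiv.ofBijective (canonicalQuotient G) hG).symm_apply_eq.2
    (canonicalQuotient_toMaximal G f).symm

/-- The extension to `C*_r(G)` of the functional `f ↦ ∑ f(γ)`, the sum taken over the isotropy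
group at `x`: the vector functional of `orbitRep` at `δ_x`. -/
def isotropyFunctional (hG : WeakContainment G) (x : unitSpace G) : ReducedCStar G →L[ℂ] ℂ :=
  vectorFunctional ((maximalOrbitRep G).comp hG.lift) (delta x)

lemma isotropyFunctional_toReduced (hG : WeakContainment G) (x : unitSpace G) (f : ConvAlg G) :
    isotropyFunctional hG x (toReduced G f) = arrowSum f x x := by
  rw [isotropyFunctional, vectorFunctional_apply, inner_delta_left,
    NonUnitalStarAlgHom.comp_apply, hG.lift_toReduced]
  exact orbitOp_delta f x x

lemma norm_isotropyFunctional_le (hG : WeakContainment G) (x : unitSpace G) :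
    ‖isotropyFunctional hG x‖ ≤ 1 := by
  refine (norm_vectorFunctional_le _ _).trans ?_
  rw [norm_delta, one_mul]

lemma isotropyFunctional_nonneg (hG : WeakContainment G) (x : unitSpace G) (a : ReducedCStar G) :
    0 ≤ isotropyFunctional hG x (star a * a) := vectorFunctional_nonneg _ _ a

lemma isotropyFunctional_unitInclusion (hG : WeakContainment G) (x : unitSpace G)
    (f : C₀(unitSpace G, ℂ)) : isotropyFunctional hG x (unitInclusion f) = f x := by
  have hF : Continuous fun f : C₀(unitSpace G, ℂ) => isotropyFunctional hG x (unitInclusion f) :=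
    (isotropyFunctional hG x).continuous.comp continuous_unitInclusion
  have heval : Continuous fun f : C₀(unitSpace G, ℂ) => f x :=
    (continuous_eval_const (F := BoundedContinuousFunction (unitSpace G) ℂ) x).comp
      ZeroAtInftyContinuousMap.isometry_toBCF.continuous
  refine congrFun (denseRange_toC0.equalizer hF heval (funext fun h => ?_)) f
  have hsum := arrowSum_of_injOn (fun γ => unitConv_of_notMem h) injOn_s_unitSpace x.2
  rw [r_unit, s_unit, unitConv_coe] at hsum
  exact (isotropyFunctional_toReduced hG x (unitConv h)).trans hsum

end OrbitRepresentation

section InvariantMeasure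

section BisectionMap
variable {G : Type*} [TopologicalSpace G] [ArrowGroupoid G] {B : Set G}

lemma IsBisection.preimage_bisectionMap (hB : IsBisection B) (V : Set (unitSpace G)) :
    bisectionMap B ⁻¹' V = Subtype.val ⁻¹' (s '' (B ∩ r ⁻¹' V)) := by
  ext ⟨x, hx⟩
  obtain ⟨γ, hγ, rfl⟩ := id hx
  rw [Set.mem_preimage, bisectionMap_s hB hγ]
  refine ⟨fun h => ⟨γ, ⟨hγ, h⟩, rfl⟩, ?_⟩
  rintro ⟨η, ⟨hη, h⟩, hs⟩
  rwa [hB.injOn_s hη hγ hs] at h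

lemma IsBisection.image_bisectionMap (hB : IsBisection B) (V : Set (unitSpace G)) :
    bisectionMap B '' (Subtype.val ⁻¹' V) = r '' (B ∩ s ⁻¹' V) := by
  ext y
  constructor
  · rintro ⟨⟨_, γ, hγ, rfl⟩, h, rfl⟩
    exact ⟨γ, ⟨hγ, h⟩, (bisectionMap_s hB hγ _).symm⟩
  · rintro ⟨γ, ⟨hγ, h⟩, rfl⟩
    exact ⟨⟨s γ, γ, hγ, rfl⟩, h, bisectionMap_s hB hγ _⟩

lemma IsBisection.injective_bisectionMap (hB : IsBisection B) :
    Function.Injective (bisectionMap B) := by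
  rintro ⟨_, γ, hγ, rfl⟩ ⟨_, η, hη, rfl⟩ h
  have hr : r γ = r η := (bisectionMap_s hB hγ _).symm.trans (h.trans (bisectionMap_s hB hη _))
  exact Subtype.ext (congrArg s (hB.injOn_r hγ hη hr))

variable [IsEtale G]

lemma IsBisection.isOpenEmbedding_bisectionMap (hB : IsBisection B) (hBo : IsOpen B) :
    IsOpenEmbedding (bisectionMap B) := by
  refine .of_continuous_injective_isOpenMap (continuous_def.2 fun V hV => ?_)
    hB.injective_bisectionMap ?_
  · rw [hB.preimage_bisectionMap]
    exact (isOpenMap_s _ (hBo.inter (hV.preimage continuous_r))).preimage continuous_subtype_val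
  · rintro _ ⟨V, hV, rfl⟩
    rw [hB.image_bisectionMap]
    exact isOpenMap_r _ (hBo.inter (hV.preimage continuous_s))

end BisectionMap

variable {G : Type*} [TopologicalSpace G] [ArrowGroupoid G] [IsEtale G]
  [MeasurableSpace (unitSpace G)] [BorelSpace (unitSpace G)] {μ : Measure (unitSpace G)}
  {B : Set G}

lemma IsInvariant.integral_eq {E : Type*} [NormedAddCommGroup E] [NormedSpace ℝ E]
    (hμ : IsInvariant μ) (hBo : IsOpen B) (hB : IsBisection B) {a b : unitSpace G → E}
    (ha : ∀ x ∉ s '' B, a x = 0) (hb : ∀ x ∉ r '' B, b x = 0)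
    (hab : ∀ γ ∈ B, a (s γ) = b (r γ)) : ∫ x, a x ∂μ = ∫ x, b x ∂μ := by
  calc ∫ x, a x ∂μ = ∫ x in s '' B, a x ∂μ :=
        (setIntegral_eq_integral_of_forall_compl_eq_zero ha).symm
    _ = ∫ x : s '' B, a x ∂(μ.comap Subtype.val) :=
        (integral_subtype_comap (isOpenMap_s B hBo).measurableSet a).symm
    _ = ∫ x : s '' B, b (bisectionMap B x) ∂(μ.comap Subtype.val) := by
        refine integral_congr_ae (Eventually.of_forall ?_)
        rintro ⟨_, γ, hγ, rfl⟩
        exact (hab γ hγ).trans (congrArg b (bisectionMap_s hB hγ _).symm)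
    _ = ∫ x in r '' B, b x ∂μ := by
        rw [hμ B hBo hB, (hB.isOpenEmbedding_bisectionMap hBo).measurableEmbedding.integral_map]
    _ = ∫ x, b x ∂μ := setIntegral_eq_integral_of_forall_compl_eq_zero hb

variable [T2Space G]

lemma IsInvariant.integral_arrowSum_mul_comm (hμ : IsInvariant μ) (hBo : IsOpen B)
    (hB : IsBisection B) (f : ConvAlg G) {g : ConvAlg G} (hg : ∀ γ ∉ B, g γ = 0) :
    ∫ x, arrowSum (f * g : ConvAlg G) x x ∂μ = ∫ x, arrowSum (g * f : ConvAlg G) x x ∂μ := by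
  have hg_s {x y : unitSpace G} (hx : x ∉ s '' B) : arrowSum g y x = 0 :=
    arrowSum_eq_zero fun γ h _ => hg γ fun hγ => hx ⟨γ, hγ, h⟩
  have hg_r {x y : unitSpace G} (hy : y ∉ r '' B) : arrowSum g y x = 0 :=
    arrowSum_eq_zero fun γ _ h => hg γ fun hγ => hy ⟨γ, hγ, h⟩
  simp only [arrowSum_mul]
  refine hμ.integral_eq hBo hB (fun x hx => ?_) (fun x hx => ?_) fun γ hγ => ?_
  · simp only [hg_s hx, mul_zero, tsum_zero]
  · simp only [hg_r hx, zero_mul, tsum_zero]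
  · rw [tsum_eq_single (r γ), tsum_eq_single (s γ), mul_comm]
    · refine fun w hw => mul_eq_zero_of_left (arrowSum_eq_zero fun η h h' => hg η fun hη => hw ?_) _
      rw [← h, hB.injOn_r hη hγ h']
    · refine fun w hw => mul_eq_zero_of_right _ (arrowSum_eq_zero fun η h h' =>
        hg η fun hη => hw ?_)
      rw [← h', hB.injOn_s hη hγ h]

end InvariantMeasure

section IsotropyTrace
variable {G : Type*} [TopologicalSpace G] [T2Space G] [ArrowGroupoid G] [IsEtale G]
  [MeasurableSpace (unitSpace G)] [BorelSpace (unitSpace G)]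

lemma measurable_arrowSum_self_of_tsupport_subset (e : OpenPartialHomeomorph G (unitSpace G))
    (he : e = (s : G → unitSpace G)) {f : ConvAlg G} (hf : tsupport f ⊆ e.source) :
    Measurable fun x => arrowSum f x x := by
  classical
  set C := s '' (tsupport f ∩ isotropy G)
  have hC : IsCompact C :=
    (f.hasCompactSupport.isCompact.inter_right isClosed_isotropy).image continuous_s
  have hf0 : ∀ γ ∉ tsupport f, f γ = 0 := fun γ => image_eq_zero_of_notMem_tsupport
  have hinj : (tsupport f).InjOn s := he ▸ e.injOn.mono hf
  have hpiecewise : (fun x => arrowSum f x x) = C.piecewise (fun x => f (e.symm x)) 0 := by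
    ext x
    by_cases hx : x ∈ C
    · rw [Set.piecewise_eq_of_mem _ _ _ hx]
      obtain ⟨γ, ⟨hγ, hiso : s γ = r γ⟩, rfl⟩ := hx
      calc arrowSum f (s γ) (s γ) = f γ := by
            conv_lhs => arg 2; rw [hiso]
            exact arrowSum_of_injOn hf0 hinj hγ
        _ = f (e.symm (s γ)) := by rw [← he, e.left_inv (hf hγ)]
    · rw [Set.piecewise_eq_of_notMem _ _ _ hx]
      exact arrowSum_eq_zero fun γ h h' => hf0 γ fun hγ => hx ⟨γ, ⟨hγ, h.trans h'.symm⟩, h⟩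
  rw [hpiecewise]
  refine ContinuousOn.measurable_piecewise (f.continuous.comp_continuousOn ?_) continuousOn_const
    hC.measurableSet
  refine e.continuousOn_symm.mono ?_
  rintro _ ⟨γ, ⟨hγ, -⟩, rfl⟩
  exact he ▸ e.map_source (hf hγ)

variable [LocallyCompactSpace G]

lemma measurable_arrowSum_self (f : ConvAlg G) : Measurable fun x => arrowSum f x x := by
  refine ConvAlg.local_induction (P := fun f => Measurable fun x => arrowSum f x x)
    ?_ (fun f g hf hg => ?_) f fun γ _ => ?_
  · simp only [arrowSum_eq_zero fun γ _ _ => ConvAlg.zero_apply γ, measurable_const]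
  · simp only [arrowSum_add]
    exact hf.add hg
  · obtain ⟨e, hγ, he⟩ := isLocalHomeomorph_s (G := G) γ
    exact ⟨e.source, e.open_source, hγ,
      fun g hg => measurable_arrowSum_self_of_tsupport_subset e he.symm hg⟩

lemma integrable_arrowSum_self (μ : Measure (unitSpace G)) [IsFiniteMeasure μ] (f : ConvAlg G) :
    Integrable (fun x => arrowSum f x x) μ := by
  refine .of_bound (measurable_arrowSum_self f).aestronglyMeasurable (iNorm f).toReal
    (Eventually.of_forall fun x => ?_)
  rw [← toReal_enorm]
  exact ENNReal.toReal_mono f.iNorm_ne_top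
    ((ENNReal.le_tsum x).trans (tsum_enorm_arrowSum_source_le f x))

lemma measurable_isotropyFunctional (hG : WeakContainment G) (a : ReducedCStar G) :
    Measurable fun x => isotropyFunctional hG x a := by
  refine measurable_apply_of_denseRange denseRange_toReduced (fun f => ?_) a
  simpa only [isotropyFunctional_toReduced] using measurable_arrowSum_self f

section Trace
variable (hG : WeakContainment G) (μ : Measure (unitSpace G)) [IsFiniteMeasure μ]

/-- The functional on `C*_r(G)` extending `f ↦ ∫ ∑_{γ ∈ G_x^x} f(γ) dμ(x)`, where `G_x^x` is the
isotropy group at `x`. It is a trace if `μ` is invariant. -/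
def isotropyTrace : ReducedCStar G →L[ℂ] ℂ :=
  integralFunctional μ (isotropyFunctional hG) (measurable_isotropyFunctional hG)
    (norm_isotropyFunctional_le hG)

lemma isotropyTrace_apply (a : ReducedCStar G) :
    isotropyTrace hG μ a = ∫ x, isotropyFunctional hG x a ∂μ := integralFunctional_apply ..

lemma norm_isotropyTrace_le : ‖isotropyTrace hG μ‖ ≤ μ.real Set.univ :=
  (norm_integralFunctional_le μ zero_le_one _ _).trans_eq (one_mul _)

lemma isotropyTrace_toReduced (f : ConvAlg G) :
    isotropyTrace hG μ (toReduced G f) = ∫ x, arrowSum f x x ∂μ := by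
  simp only [isotropyTrace_apply, isotropyFunctional_toReduced]

lemma isAssociatedMeasure_isotropyTrace : IsAssociatedMeasure (isotropyTrace hG μ) μ := fun f => by
  simp only [isotropyTrace_apply, isotropyFunctional_unitInclusion]

variable {μ}

lemma isotropyTrace_mul_comm (hμ : IsInvariant μ) (a b : ReducedCStar G) :
    isotropyTrace hG μ (a * b) = isotropyTrace hG μ (b * a) := by
  set τ := isotropyTrace hG μ
  refine denseRange_toReduced.induction_on₂ (p := fun a b => τ (a * b) = τ (b * a)) ?_
    (fun f g => ?_) a b
  · exact isClosed_eq (τ.continuous.comp (continuous_fst.mul continuous_snd))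
      (τ.continuous.comp (continuous_snd.mul continuous_fst))
  refine ConvAlg.local_induction (P := fun g => τ (toReduced G f * toReduced G g) =
    τ (toReduced G g * toReduced G f)) ?_ (fun g g' hg hg' => ?_) g fun γ _ => ?_
  · rw [toReduced_zero, mul_zero, zero_mul]
  · rw [toReduced_add, mul_add, add_mul, map_add, map_add, hg, hg']
  · obtain ⟨U, hU, hγU, hUb⟩ := exists_isOpen_isBisection γ
    refine ⟨U, hU, hγU, fun g hg => ?_⟩
    rw [← toReduced_mul, ← toReduced_mul, isotropyTrace_toReduced, isotropyTrace_toReduced]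
    exact hμ.integral_arrowSum_mul_comm hU hUb f
      fun η hη => image_eq_zero_of_notMem_tsupport fun h => hη (hg h)

end Trace

end IsotropyTrace

section Mass

lemma measureReal_le_integral_of_one_le_on {X : Type*} [MeasurableSpace X] {μ : Measure X}
    {g : X → ℝ} (hg : Integrable g μ) (h0 : ∀ x, 0 ≤ g x) {S : Set X} (hS : ∀ x ∈ S, 1 ≤ g x) :
    μ.real S ≤ ∫ x, g x ∂μ :=
  calc μ.real S ≤ μ.real {x | 1 ≤ g x} := measureReal_mono hS (hg.measure_ge_lt_top one_pos).ne
    _ = 1 * μ.real {x | 1 ≤ g x} := (one_mul _).symm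
    _ ≤ ∫ x, g x ∂μ := mul_meas_ge_le_integral_of_nonneg (ae_of_all μ h0) hg 1

variable {G : Type*} [TopologicalSpace G] [ArrowGroupoid G]

lemma norm_toC0_toComplex_le_one {χ : C_c(unitSpace G, ℝ)} (hχ : ∀ x, χ x ∈ Set.Icc (0 : ℝ) 1) :
    ‖toC0 (toComplex χ)‖ ≤ 1 := by
  rw [← ZeroAtInftyContinuousMap.norm_toBCF_eq_norm, BoundedContinuousFunction.norm_le zero_le_one]
  intro x
  change ‖toComplex χ x‖ ≤ 1
  rw [toComplex_apply, Complex.norm_of_nonneg (hχ x).1]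
  exact (hχ x).2

variable [T2Space G] [LocallyCompactSpace G] [IsEtale G] [MeasurableSpace (unitSpace G)]
  [BorelSpace (unitSpace G)] {μ : Measure (unitSpace G)} {τ : ReducedCStar G →L[ℂ] ℂ}

lemma IsAssociatedMeasure.measureReal_le_norm [IsFiniteMeasureOnCompacts μ]
    (hμ : IsAssociatedMeasure τ μ) {K : Set (unitSpace G)} (hK : IsCompact K) :
    μ.real K ≤ ‖τ‖ := by
  obtain ⟨χ, hχK, -, hχ⟩ := exists_cutoff hK isOpen_univ (Set.subset_univ K)
  calc μ.real K ≤ ∫ x, χ x ∂μ := measureReal_le_integral_of_one_le_on χ.integrable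
        (fun x => (hχ x).1) fun x hx => (hχK hx).ge
    _ = ‖τ (unitInclusion (toC0 (toComplex χ)))‖ := by
        have hint : τ (unitInclusion (toC0 (toComplex χ))) = ((∫ x, χ x ∂μ : ℝ) : ℂ) :=
          (hμ _).trans ((integral_congr_ae (ae_of_all μ (toComplex_apply χ))).trans
            integral_complex_ofReal)
        rw [hint, Complex.norm_of_nonneg (integral_nonneg fun x => (hχ x).1)]
    _ ≤ ‖τ‖ * 1 := τ.le_opNorm_of_le
        ((norm_unitInclusion_le _).trans (norm_toC0_toComplex_le_one hχ))
    _ = ‖τ‖ := mul_one _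

lemma IsAssociatedMeasure.measureReal_univ_le_norm [IsFiniteMeasure μ] [μ.Regular]
    (hμ : IsAssociatedMeasure τ μ) : μ.real Set.univ ≤ ‖τ‖ := by
  refine ENNReal.toReal_le_of_le_ofReal (norm_nonneg τ) ?_
  rw [isOpen_univ.measure_eq_iSup_isCompact]
  exact iSup₂_le fun K _ => iSup_le fun hK =>
    (ENNReal.le_ofReal_iff_toReal_le (measure_ne_top μ K) (norm_nonneg τ)).2
      (hμ.measureReal_le_norm hK)

end Mass

section EssentialFreeness
variable {G : Type*} [TopologicalSpace G] [T2Space G] [LocallyCompactSpace G]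
  [ArrowGroupoid G] [IsEtale G] [MeasurableSpace (unitSpace G)] [BorelSpace (unitSpace G)]
  (hG : WeakContainment G) {μ : Measure (unitSpace G)}

lemma isTracialState_isotropyTrace [IsProbabilityMeasure μ] [μ.Regular] (hμ : IsInvariant μ) :
    IsTracialState (isotropyTrace hG μ) where
  nonneg a := by
    rw [isotropyTrace_apply]
    exact integral_nonneg fun x => isotropyFunctional_nonneg hG x a
  norm_eq_one := ((norm_isotropyTrace_le hG μ).antisymm
    (isAssociatedMeasure_isotropyTrace hG μ).measureReal_univ_le_norm).trans probReal_univ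
  tracial := isotropyTrace_mul_comm hG hμ

lemma measureReal_image_s_le_re_integral_arrowSum [IsFiniteMeasure μ] {f : ConvAlg G}
    (hf : ∀ γ, 0 ≤ f γ) {L : Set G} (hL : L ⊆ isotropy G) (hfL : ∀ γ ∈ L, 1 ≤ f γ) :
    μ.real (s '' L) ≤ (∫ x, arrowSum f x x ∂μ).re := by
  have hint : Integrable (fun x => arrowSum f x x) μ := integrable_arrowSum_self μ f
  have hnonneg (x : unitSpace G) : 0 ≤ arrowSum f x x :=
    tsum_nonneg fun γ => Set.indicator_nonneg (fun γ _ => hf γ) γ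
  refine (measureReal_le_integral_of_one_le_on hint.re
    (fun x => (Complex.nonneg_iff.1 (hnonneg x)).1) ?_).trans_eq (integral_re hint)
  rintro _ ⟨γ, hγ, rfl⟩
  have hle : 1 ≤ arrowSum f (s γ) (s γ) := by
    conv_rhs => arg 2; rw [show s γ = r γ from hL hγ]
    exact (hfL γ hγ).trans (apply_le_arrowSum hf γ)
  exact (Complex.le_def.1 hle).1

variable [IsFiniteMeasure μ] (hcan : IsCanonical (isotropyTrace hG μ))
include hcan

lemma integral_arrowSum_self_eq_zero_of_isCanonical {f : ConvAlg G}
    (hf : ∀ x : unitSpace G, f x = 0) : ∫ x, arrowSum f x x ∂μ = 0 := by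
  obtain ⟨ν, -, -, -, hν⟩ := hcan
  rw [← isotropyTrace_toReduced hG, hν, traceOf_toReduced]
  simp only [hf, integral_zero]

lemma measure_image_s_eq_zero_of_isCanonical {L : Set G} (hL : IsCompact L)
    (hLiso : L ⊆ isotropy G) (hLunit : L ⊆ (unitSpace G)ᶜ) : μ (s '' L) = 0 := by
  obtain ⟨φ, hφL, hφ, hφ01⟩ := exists_cutoff hL isClosed_unitSpace.isOpen_compl hLunit
  let f : ConvAlg G := toComplex φ
  have hf (γ : G) : f γ = φ γ := toComplex_apply φ γ
  have hzero : ∫ x, arrowSum f x x ∂μ = 0 :=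
    integral_arrowSum_self_eq_zero_of_isCanonical hG hcan fun x => by
      rw [hf, image_eq_zero_of_notMem_tsupport fun h => hφ h x.2, Complex.ofReal_zero]
  have hle : μ.real (s '' L) ≤ 0 := by
    refine (measureReal_image_s_le_re_integral_arrowSum (f := f) (fun γ => ?_) hLiso
      fun γ hγ => ?_).trans_eq (by rw [hzero, Complex.zero_re])
    · exact hf γ ▸ Complex.zero_le_real.2 (hφ01 γ).1
    · rw [hf, hφL hγ, Pi.one_apply, Complex.ofReal_one]
  exact (measureReal_eq_zero_iff (measure_ne_top μ _)).1 (hle.antisymm measureReal_nonneg)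

theorem isEssentiallyFree_of_isCanonical_isotropyTrace [μ.Regular] : IsEssentiallyFree μ := by
  intro B hBo hB _ hBunit
  by_contra hpos
  obtain ⟨K, hKB, hK, hKpos⟩ := (hB.measurableSet_fixedPoints hBo).exists_lt_isCompact_of_ne_top
    (measure_ne_top μ _) (pos_iff_ne_zero.2 hpos)
  rw [hB.fixedPoints_eq] at hKB
  set L : Set G := Subtype.val '' ((fun γ : B => s (γ : G)) ⁻¹' K)
  have hL : IsCompact L := by
    refine IsCompact.image ?_ continuous_subtype_val
    refine (hB.1.isInducing.isCompact_preimage_iff fun x hx => ?_).2 hK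
    obtain ⟨γ, hγ, h⟩ := hKB hx
    exact ⟨⟨γ, hγ.1⟩, h⟩
  have hLB : L ⊆ B := Subtype.coe_image_subset _ _
  have hLiso : L ⊆ isotropy G := by
    rintro _ ⟨γ, hγ, rfl⟩
    obtain ⟨η, hη, h⟩ := hKB hγ
    rw [← hB.injOn_s hη.1 γ.2 h]
    exact hη.2
  have hKL : K ⊆ s '' L := fun x hx => by
    obtain ⟨γ, hγ, rfl⟩ := hKB hx
    exact ⟨γ, ⟨⟨γ, hγ.1⟩, hx, rfl⟩, rfl⟩
  exact hKpos.ne' (measure_mono_null hKL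
    (measure_image_s_eq_zero_of_isCanonical hG hcan hL hLiso (hLB.trans hBunit)))

end EssentialFreeness

end GroupoidCStar
end

theorem mainTheorem6 {G : Type*} [TopologicalSpace G] [T2Space G] [LocallyCompactSpace G]
    [ArrowGroupoid G] [IsEtale G] (hG : WeakContainment G)
    [MeasurableSpace (unitSpace G)] [BorelSpace (unitSpace G)]
    (μ : Measure (unitSpace G)) [IsProbabilityMeasure μ] [μ.Regular] (hμ : IsInvariant μ) :
    IsEssentiallyFree μ ↔
      ∀ τ : ReducedCStar G →L[ℂ] ℂ,
        IsTracialState τ → IsAssociatedMeasure τ μ → IsCanonical τ :=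
  ⟨fun hfree _ hτ hτμ => hfree.isCanonical hτ hτμ, fun hcan =>
    isEssentiallyFree_of_isCanonical_isotropyTrace hG
      (hcan _ (isTracialState_isotropyTrace hG hμ) (isAssociatedMeasure_isotropyTrace hG μ))⟩
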